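/- Let $A$ be an associative unital ring (for instance an algebra over a commutative ring $k$), let $\mathcal C$ be an $A$-coring, i.e. a comonoid in the category of $A$-$A$ bimodules, with coproduct $c\mapsto c^{(1)}\otimes_A c^{(2)}$ and counit $\epsilon$, and suppose that $\mathcal C$ is finitely generated and projective as a left $A$-module. Let $\Sigma$ be a right $\mathcal C$-comodule with coaction $x\mapsto x^{[0]}\otimes_A x^{[1]}$, and let $T=\mathrm{End}^{\mathcal C}(\Sigma)$ be its ring of comodule endomorphisms, acting on $\Sigma$ from the left. Let ${}^*\mathcal C={}_A\mathrm{Hom}(\mathcal C,A)$ be the ring with multiplication $(ff')(c)=f'(c^{(1)}f(c^{(2)}))$ and unit $\epsilon$, which is a right $A$-module by $(fa)(c)=f(c)a$; it acts on every right $\mathcal C$-comodule from the right by $xf=x^{[0]}f(x^{[1]})$. Let $$Q=\{\,q\in\mathrm{Hom}_A(\Sigma,{}^*\mathcal C)\ :\ q(x^{[0]})(c)\,x^{[1]}=c^{(1)}q(x)(c^{(2)})\ \text{ for all } x\in\Sigma,\ c\in\mathcal C\,\},$$ a ${}^*\mathcal C$-$T$ bimodule by $(fq)(x)=f\,q(x)$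 and $(qt)(x)=q(t(x))$, and let $\mathbb M(\Sigma)=(T,{}^*\mathcal C,\Sigma,Q)$ be the Morita context with connecting maps $$Q\otimes_T\Sigma\to{}^*\mathcal C,\quad q\otimes x\mapsto q(x),\qquad\qquad \Sigma\otimes_{{}^*\mathcal C}Q\to T,\quad x\otimes q\mapsto\big(y\mapsto x\,q(y)\big).$$ Then the following are equivalent. 1. The Morita context $\mathbb M(\Sigma)$ is strict, i.e. both connecting maps are isomorphisms. 2. $\Sigma$ is a Galois comodule, i.e. for every right $A$-module $N$ the map $\mathrm{Hom}_A(\Sigma,N)\otimes_T\Sigma\to N\otimes_A\mathcal C$, $\varphi\otimes x\mapsto\varphi(x^{[0]})\otimes x^{[1]}$, is bijective; moreover $\Sigma$ is finitely generated and projective as a right $A$-module and faithfully flat as a left $T$-module. 3. The functor $-\otimes_T\Sigma:\mathcal M_T\to\mathcal M^{\mathcal C}$ from right $T$-modules to right $\mathcal C$-comodules is an equivalence of categories with inverse $\mathrm{Hom}^{\mathcal C}(\Sigma,-)$. -/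

import Mathlib

open MulOpposite

universe u

namespace CoringMorita

/-! Right modules over a ring `R` are modules over `Rᵐᵒᵖ`; the product `m · r` is `op r • m`.
An `R`-`S` bimodule carries `Module R`, `Module Sᵐᵒᵖ` and `SMulCommClass R Sᵐᵒᵖ`. -/

/-! ### The tensor product over a noncommutative ring -/

section Tensor

open scoped TensorProduct

/-- The subgroup of `M ⊗[ℤ] N` generated by all `m · r ⊗ n - m ⊗ r · n`. -/
def balRel (R M N : Type*) [Ring R] [AddCommGroup M] [Module Rᵐᵒᵖ M] [AddCommGroup N]
    [Module R N] : AddSubgroup (M ⊗[ℤ] N) :=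
  AddSubgroup.closure {z | ∃ (m : M) (r : R) (n : N), z = (op r • m) ⊗ₜ[ℤ] n - m ⊗ₜ[ℤ] (r • n)}

/-- The tensor product `M ⊗_R N` of a right `R`-module `M` and a left `R`-module `N`. -/
def BalTensor (R M N : Type*) [Ring R] [AddCommGroup M] [Module Rᵐᵒᵖ M] [AddCommGroup N]
    [Module R N] : Type _ :=
  (M ⊗[ℤ] N) ⧸ balRel R M N

namespace BalTensor

variable {R M N M' N' M'' N'' P : Type*} [Ring R]
  [AddCommGroup M] [Module Rᵐᵒᵖ M] [AddCommGroup N] [Module R N]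
  [AddCommGroup M'] [Module Rᵐᵒᵖ M'] [AddCommGroup N'] [Module R N']
  [AddCommGroup M''] [Module Rᵐᵒᵖ M''] [AddCommGroup N''] [Module R N'']
  [AddCommGroup P]

instance : AddCommGroup (BalTensor R M N) :=
  inferInstanceAs (AddCommGroup ((M ⊗[ℤ] N) ⧸ balRel R M N))

/-- The pure tensor `m ⊗_R n`. -/
def tmul (R : Type*) {M N : Type*} [Ring R] [AddCommGroup M] [Module Rᵐᵒᵖ M] [AddCommGroup N]
    [Module R N] (m : M) (n : N) : BalTensor R M N :=
  QuotientAddGroup.mk' (balRel R M N) (m ⊗ₜ[ℤ] n)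

theorem add_tmul (m m' : M) (n : N) : tmul R (m + m') n = tmul R m n + tmul R m' n := by
  simp only [tmul, TensorProduct.add_tmul]; exact map_add _ _ _

theorem tmul_add (m : M) (n n' : N) : tmul R m (n + n') = tmul R m n + tmul R m n' := by
  simp only [tmul, TensorProduct.tmul_add]; exact map_add _ _ _

theorem zero_tmul (n : N) : tmul R (0 : M) n = 0 := by
  simp only [tmul, TensorProduct.zero_tmul]; exact map_zero _

theorem tmul_zero (m : M) : tmul R m (0 : N) = 0 := by
  simp only [tmul, TensorProduct.tmul_zero]; exact map_zero _

theorem smul_tmul (m : M) (r : R) (n : N) : tmul R (op r • m) n = tmul R m (r • n) := by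
  refine (QuotientAddGroup.eq_iff_sub_mem).2 ?_
  exact AddSubgroup.subset_closure ⟨m, r, n, rfl⟩

theorem induction {motive : BalTensor R M N → Prop} (z : BalTensor R M N) (zero : motive 0)
    (tmul : ∀ m n, motive (tmul R m n)) (add : ∀ x y, motive x → motive y → motive (x + y)) :
    motive z := by
  obtain ⟨t, rfl⟩ := QuotientAddGroup.mk'_surjective (balRel R M N) z
  induction t using TensorProduct.induction_on with
  | zero => exact (map_zero (QuotientAddGroup.mk' (balRel R M N))).symm ▸ zero
  | tmul m n => exact tmul m n
  | add x y hx hy => exact (map_add (QuotientAddGroup.mk' (balRel R M N)) x y).symm ▸ add _ _ hx hy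

/-- The universal property: a biadditive `R`-balanced map factors through `M ⊗_R N`. -/
def lift (f : M →+ N →+ P) (hf : ∀ m (r : R) n, f (op r • m) n = f m (r • n)) :
    BalTensor R M N →+ P :=
  QuotientAddGroup.lift (balRel R M N)
    (TensorProduct.liftAddHom f fun z m n => by simp) (by
      refine (AddSubgroup.closure_le _).2 ?_
      rintro _ ⟨m, r, n, rfl⟩
      simp [hf])

@[simp] theorem lift_tmul (f : M →+ N →+ P) (hf : ∀ m (r : R) n, f (op r • m) n = f m (r • n))
    (m : M) (n : N) : lift f hf (tmul R m n) = f m n :=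
  rfl

theorem hom_ext {f g : BalTensor R M N →+ P} (h : ∀ m n, f (tmul R m n) = g (tmul R m n)) :
    f = g := by
  ext z
  induction z using induction with
  | zero => simp
  | tmul m n => exact h m n
  | add x y hx hy => simp [hx, hy]

theorem hom_ext_apply {f g : BalTensor R M N →+ P}
    (h : ∀ m n, f (tmul R m n) = g (tmul R m n)) (z : BalTensor R M N) : f z = g z := by
  rw [hom_ext h]

/-- Build a homomorphism out of `M ⊗_R N` from an unbundled biadditive balanced map. -/
def lift' (f : M → N → P) (h₁ : ∀ m m' n, f (m + m') n = f m n + f m' n)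
    (h₂ : ∀ m n n', f m (n + n') = f m n + f m n')
    (h₃ : ∀ m (r : R) n, f (op r • m) n = f m (r • n)) : BalTensor R M N →+ P :=
  lift (AddMonoidHom.mk' (fun m => AddMonoidHom.mk' (f m) (h₂ m))
    fun m m' => by ext n; exact h₁ m m' n) h₃

@[simp] theorem lift'_tmul (f : M → N → P) (h₁ : ∀ m m' n, f (m + m') n = f m n + f m' n)
    (h₂ : ∀ m n n', f m (n + n') = f m n + f m n')
    (h₃ : ∀ m (r : R) n, f (op r • m) n = f m (r • n)) (m : M) (n : N) :
    lift' f h₁ h₂ h₃ (tmul R m n) = f m n :=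
  rfl

/-- The map `f ⊗_R g`. -/
def map (f : M →ₗ[Rᵐᵒᵖ] M') (g : N →ₗ[R] N') : BalTensor R M N →+ BalTensor R M' N' :=
  lift' (fun m n => tmul R (f m) (g n)) (fun m m' n => by rw [map_add, add_tmul])
    (fun m n n' => by rw [map_add, tmul_add])
    (fun m r n => by rw [map_smul, map_smul, smul_tmul])

@[simp] theorem map_tmul (f : M →ₗ[Rᵐᵒᵖ] M') (g : N →ₗ[R] N') (m : M) (n : N) :
    map f g (tmul R m n) = tmul R (f m) (g n) :=
  rfl

theorem map_id (z : BalTensor R M N) :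
    map (LinearMap.id : M →ₗ[Rᵐᵒᵖ] M) (LinearMap.id : N →ₗ[R] N) z = z :=
  hom_ext_apply (f := map LinearMap.id LinearMap.id) (g := AddMonoidHom.id _) (fun _ _ => rfl) z

theorem map_comp (f' : M' →ₗ[Rᵐᵒᵖ] M'') (g' : N' →ₗ[R] N'') (f : M →ₗ[Rᵐᵒᵖ] M')
    (g : N →ₗ[R] N') (z : BalTensor R M N) :
    map (f' ∘ₗ f) (g' ∘ₗ g) z = map f' g' (map f g z) :=
  hom_ext_apply (f := map (f' ∘ₗ f) (g' ∘ₗ g)) (g := (map f' g').comp (map f g))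
    (fun _ _ => rfl) z

theorem map_add_left (f f' : M →ₗ[Rᵐᵒᵖ] M') (g : N →ₗ[R] N') (z : BalTensor R M N) :
    map (f + f') g z = map f g z + map f' g z :=
  hom_ext_apply (g := map f g + map f' g) (fun _ _ => add_tmul _ _ _) z

theorem map_zero_left (g : N →ₗ[R] N') (z : BalTensor R M N) :
    map (0 : M →ₗ[Rᵐᵒᵖ] M') g z = 0 :=
  hom_ext_apply (g := 0) (fun _ _ => zero_tmul _) z

theorem map_add_right (f : M →ₗ[Rᵐᵒᵖ] M') (g g' : N →ₗ[R] N') (z : BalTensor R M N) :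
    map f (g + g') z = map f g z + map f g' z :=
  hom_ext_apply (g := map f g + map f g') (fun _ _ => tmul_add _ _ _) z

theorem map_zero_right (f : M →ₗ[Rᵐᵒᵖ] M') (z : BalTensor R M N) :
    map f (0 : N →ₗ[R] N') z = 0 :=
  hom_ext_apply (g := 0) (fun _ _ => tmul_zero _) z

section Actions

variable {S S' : Type*} [Ring S] [Ring S']

/-- Left multiplication by `s` on an `S`-`R` bimodule, as a right `R`-linear map. -/
def lmul (R : Type*) {M S : Type*} [Ring R] [Ring S] [AddCommGroup M] [Module Rᵐᵒᵖ M] [Module S M]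
    [SMulCommClass S Rᵐᵒᵖ M] (s : S) : M →ₗ[Rᵐᵒᵖ] M where
  toFun m := s • m
  map_add' := smul_add s
  map_smul' r m := smul_comm s r m

/-- Right multiplication by `s` on an `R`-`S` bimodule, as a left `R`-linear map. -/
def rmul (R : Type*) {N S : Type*} [Ring R] [Ring S] [AddCommGroup N] [Module R N] [Module Sᵐᵒᵖ N]
    [SMulCommClass R Sᵐᵒᵖ N] (s : Sᵐᵒᵖ) : N →ₗ[R] N where
  toFun n := s • n
  map_add' := smul_add s
  map_smul' r n := (smul_comm r s n).symm

/-- The left action `s · (m ⊗ n) = s · m ⊗ n` for an `S`-`R` bimodule `M`. -/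
instance (priority := 100) leftModule [Module S M] [SMulCommClass S Rᵐᵒᵖ M] :
    Module S (BalTensor R M N) where
  smul s z := map (lmul R s) LinearMap.id z
  one_smul z := by
    refine Eq.trans ?_ (map_id z)
    change map _ _ z = _
    congr 2; ext m; exact one_smul S m
  mul_smul s t z := by
    change map _ _ z = map _ _ (map _ _ z)
    rw [← map_comp]
    congr 2; ext m; exact mul_smul s t m
  smul_zero s := map_zero _
  smul_add s := map_add _
  add_smul s t z := by
    change map _ _ z = map _ _ z + map _ _ z
    rw [← map_add_left]
    congr 2; ext m; exact add_smul s t m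
  zero_smul z := by
    refine Eq.trans ?_ (map_zero_left LinearMap.id z)
    change map _ _ z = _
    congr 2; ext m; exact zero_smul S m

/-- The right action `(m ⊗ n) · s = m ⊗ n · s` for an `R`-`S` bimodule `N`. -/
instance rightModule [Module Sᵐᵒᵖ N] [SMulCommClass R Sᵐᵒᵖ N] :
    Module Sᵐᵒᵖ (BalTensor R M N) where
  smul s z := map LinearMap.id (rmul R s) z
  one_smul z := by
    refine Eq.trans ?_ (map_id z)
    change map _ _ z = _
    congr 2; ext m; exact one_smul Sᵐᵒᵖ m
  mul_smul s t z := by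
    change map _ _ z = map _ _ (map _ _ z)
    rw [← map_comp]
    congr 2; ext m; exact mul_smul s t m
  smul_zero s := map_zero _
  smul_add s := map_add _
  add_smul s t z := by
    change map _ _ z = map _ _ z + map _ _ z
    rw [← map_add_right]
    congr 2; ext m; exact add_smul s t m
  zero_smul z := by
    refine Eq.trans ?_ (map_zero_right LinearMap.id z)
    change map _ _ z = _
    congr 2; ext m; exact zero_smul Sᵐᵒᵖ m

@[simp] theorem left_smul_tmul [Module S M] [SMulCommClass S Rᵐᵒᵖ M] (s : S) (m : M) (n : N) :
    s • tmul R m n = tmul R (s • m) n :=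
  rfl

@[simp] theorem right_smul_tmul [Module Sᵐᵒᵖ N] [SMulCommClass R Sᵐᵒᵖ N] (s : Sᵐᵒᵖ) (m : M)
    (n : N) : s • tmul R m n = tmul R m (s • n) :=
  rfl

instance [Module S M] [SMulCommClass S Rᵐᵒᵖ M] [Module S'ᵐᵒᵖ N] [SMulCommClass R S'ᵐᵒᵖ N] :
    SMulCommClass S S'ᵐᵒᵖ (BalTensor R M N) where
  smul_comm s s' z := by
    change map _ _ (map _ _ z) = map _ _ (map _ _ z)
    rw [← map_comp, ← map_comp]
    rfl

/-- An additive map that commutes with the left action on pure tensors is left linear. -/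
theorem map_left_smul [Module S M] [SMulCommClass S Rᵐᵒᵖ M] [Module S P]
    (f : BalTensor R M N →+ P) (h : ∀ (s : S) m n, f (tmul R (s • m) n) = s • f (tmul R m n))
    (s : S) (z : BalTensor R M N) : f (s • z) = s • f z := by
  induction z using induction with
  | zero => simp
  | tmul m n => exact h s m n
  | add x y hx hy => simp [smul_add, hx, hy]

/-- An additive map that commutes with the right action on pure tensors is right linear. -/
theorem map_right_smul [Module Sᵐᵒᵖ N] [SMulCommClass R Sᵐᵒᵖ N] [Module Sᵐᵒᵖ P]
    (f : BalTensor R M N →+ P)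
    (h : ∀ (s : Sᵐᵒᵖ) m n, f (tmul R m (s • n)) = s • f (tmul R m n))
    (s : Sᵐᵒᵖ) (z : BalTensor R M N) : f (s • z) = s • f z := by
  induction z using induction with
  | zero => simp
  | tmul m n => exact h s m n
  | add x y hx hy => simp [smul_add, hx, hy]

/-- `f ⊗_R N` for a right `R`-linear map `f`, as a right `S`-linear map. -/
def rTensor (N : Type*) [AddCommGroup N] [Module R N] [Module Sᵐᵒᵖ N] [SMulCommClass R Sᵐᵒᵖ N]
    (f : M →ₗ[Rᵐᵒᵖ] M') : BalTensor R M N →ₗ[Sᵐᵒᵖ] BalTensor R M' N where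
  toFun := map f LinearMap.id
  map_add' := map_add _
  map_smul' := map_right_smul (map f LinearMap.id) fun _ _ _ => rfl

@[simp] theorem rTensor_tmul [Module Sᵐᵒᵖ N] [SMulCommClass R Sᵐᵒᵖ N] (f : M →ₗ[Rᵐᵒᵖ] M')
    (m : M) (n : N) : rTensor (S := S) N f (tmul R m n) = tmul R (f m) n :=
  rfl

end Actions

section Assoc

variable {S Q : Type*} [Ring S] [Module Sᵐᵒᵖ N] [SMulCommClass R Sᵐᵒᵖ N]
  [AddCommGroup Q] [Module S Q]

/-- `(M ⊗_R N) ⊗_S Q → M ⊗_R (N ⊗_S Q)`, `(m ⊗ n) ⊗ q ↦ m ⊗ (n ⊗ q)`. -/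
def assocHom : BalTensor S (BalTensor R M N) Q →+ BalTensor R M (BalTensor S N Q) :=
  lift' (fun z q => lift' (fun m n => tmul R m (tmul S n q))
      (fun _ _ _ => add_tmul _ _ _) (fun _ _ _ => by rw [add_tmul, tmul_add])
      (fun m r n => by rw [smul_tmul, left_smul_tmul]) z)
    (fun _ _ _ => map_add _ _ _)
    (fun z q q' => by
      induction z using induction with
      | zero => simp
      | tmul m n => simp [tmul_add]
      | add x y hx hy => simp only [map_add, hx, hy]; abel)
    (fun z s q => by
      induction z using induction with
      | zero => simp
      | tmul m n => simp [smul_tmul]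
      | add x y hx hy => simp only [smul_add, map_add, hx, hy])

/-- `M ⊗_R (N ⊗_S Q) → (M ⊗_R N) ⊗_S Q`, `m ⊗ (n ⊗ q) ↦ (m ⊗ n) ⊗ q`. -/
def assocInv : BalTensor R M (BalTensor S N Q) →+ BalTensor S (BalTensor R M N) Q :=
  lift' (fun m z => lift' (fun n q => tmul S (tmul R m n) q)
      (fun _ _ _ => by rw [tmul_add, add_tmul]) (fun _ _ _ => tmul_add _ _ _)
      (fun n s q => by rw [← smul_tmul, right_smul_tmul]) z)
    (fun m m' z => by
      induction z using induction with
      | zero => simp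
      | tmul n q => simp [add_tmul]
      | add x y hx hy => simp only [map_add, hx, hy]; abel)
    (fun _ _ _ => map_add _ _ _)
    (fun m r z => by
      induction z using induction with
      | zero => simp
      | tmul n q => simp [smul_tmul]
      | add x y hx hy => simp only [smul_add, map_add, hx, hy])

@[simp] theorem assocHom_tmul (m : M) (n : N) (q : Q) :
    assocHom (tmul S (tmul R m n) q) = tmul R m (tmul S n q) :=
  rfl

@[simp] theorem assocInv_tmul (m : M) (n : N) (q : Q) :
    assocInv (tmul R m (tmul S n q)) = tmul S (tmul R m n) q :=
  rfl

/-- The associativity isomorphism `(M ⊗_R N) ⊗_S Q ≃ M ⊗_R (N ⊗_S Q)`. -/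
def assoc : BalTensor S (BalTensor R M N) Q ≃+ BalTensor R M (BalTensor S N Q) where
  toFun := assocHom
  invFun := assocInv
  left_inv z := by
    refine hom_ext_apply (f := assocInv.comp assocHom) (g := AddMonoidHom.id _) (fun w q => ?_) z
    induction w using induction with
    | zero => simp [zero_tmul]
    | tmul m n => rfl
    | add x y hx hy => rw [add_tmul, map_add, map_add, hx, hy]
  right_inv z := by
    refine hom_ext_apply (f := assocHom.comp assocInv) (g := AddMonoidHom.id _) (fun m w => ?_) z
    induction w using induction with
    | zero => simp [tmul_zero]
    | tmul n q => rfl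
    | add x y hx hy => rw [tmul_add, map_add, map_add, hx, hy]
  map_add' := map_add _

@[simp] theorem assoc_tmul (m : M) (n : N) (q : Q) :
    assoc (tmul S (tmul R m n) q) = tmul R m (tmul S n q) :=
  rfl

@[simp] theorem assoc_symm_tmul (m : M) (n : N) (q : Q) :
    assoc.symm (tmul R m (tmul S n q)) = tmul S (tmul R m n) q :=
  rfl

end Assoc

end BalTensor

end Tensor

/-! ### Corings and comodules -/

section Coring

open BalTensor

/-- An `A`-coring structure on the `A`-`A` bimodule `C`: a coassociative, counital, `A`-`A` bilinear
coproduct `C → C ⊗_A C` and counit `C → A`. -/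
class Coring (A : Type*) (C : Type*) [Ring A] [AddCommGroup C] [Module A C] [Module Aᵐᵒᵖ C]
    [SMulCommClass A Aᵐᵒᵖ C] where
  comul : C →+ BalTensor A C C
  comul_smul : ∀ (a : A) (c : C), comul (a • c) = a • comul c
  comul_op_smul : ∀ (a : Aᵐᵒᵖ) (c : C), comul (a • c) = a • comul c
  counit : C →ₗ[A] A
  counit_op_smul : ∀ (a : Aᵐᵒᵖ) (c : C), counit (a • c) = a • counit c
  coassoc : ∀ c : C,
    assoc (map (⟨⟨comul, map_add comul⟩, comul_op_smul⟩ : C →ₗ[Aᵐᵒᵖ] BalTensor A C C)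
      LinearMap.id (comul c)) =
    map LinearMap.id (⟨⟨comul, map_add comul⟩, comul_smul⟩ : C →ₗ[A] BalTensor A C C) (comul c)
  counit_left : ∀ c : C,
    lift' (fun (d e : C) => counit d • e) (fun _ _ _ => by rw [map_add, add_smul])
      (fun _ _ _ => smul_add _ _ _)
      (fun d a e => by rw [counit_op_smul, op_smul_eq_mul, mul_smul]) (comul c) = c
  counit_right : ∀ c : C,
    lift' (fun (d e : C) => op (counit e) • d) (fun _ _ _ => smul_add _ _ _)
      (fun _ _ _ => by rw [map_add, op_add, add_smul])
      (fun d a e => by rw [map_smul, smul_eq_mul, op_mul, mul_smul]) (comul c) = c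

variable (A : Type*) (C : Type*) [Ring A] [AddCommGroup C] [Module A C]

/-- The left dual `*C = _A Hom(C, A)` of a coring. -/
def LeftDual : Type _ := C →ₗ[A] A

variable {A C} in
/-- The linear map underlying an element of `*C`. -/
def LeftDual.toLin (f : LeftDual A C) : C →ₗ[A] A := f

instance : FunLike (LeftDual A C) C A := inferInstanceAs (FunLike (C →ₗ[A] A) C A)

instance : AddCommGroup (LeftDual A C) := inferInstanceAs (AddCommGroup (C →ₗ[A] A))

/-- The right `A`-action `(f · a)(c) = f(c) a` on `*C`. -/
instance : Module Aᵐᵒᵖ (LeftDual A C) := inferInstanceAs (Module Aᵐᵒᵖ (C →ₗ[A] A))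

variable {A C}

@[ext] theorem LeftDual.ext {f g : LeftDual A C} (h : ∀ c, f c = g c) : f = g :=
  LinearMap.ext h

theorem LeftDual.add_apply (f g : LeftDual A C) (c : C) : (f + g) c = f c + g c := rfl

theorem LeftDual.zero_apply (c : C) : (0 : LeftDual A C) c = 0 := rfl

theorem LeftDual.op_smul_apply (a : Aᵐᵒᵖ) (f : LeftDual A C) (c : C) :
    (a • f) c = f c * a.unop := rfl

theorem LeftDual.map_add (f : LeftDual A C) (c d : C) : f (c + d) = f c + f d :=
  LinearMap.map_add f.toLin c d

theorem LeftDual.map_zero (f : LeftDual A C) : f (0 : C) = 0 :=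
  LinearMap.map_zero f.toLin

theorem LeftDual.map_smul (f : LeftDual A C) (a : A) (c : C) : f (a • c) = a * f c :=
  LinearMap.map_smul f.toLin a c

variable (A C) [Module Aᵐᵒᵖ C] [SMulCommClass A Aᵐᵒᵖ C]

/-- The map `M ⊗_A C → M`, `m ⊗ c ↦ m · f(c)`, for a left `A`-linear map `f : C → A`. -/
def actMap {A C : Type*} [Ring A] [AddCommGroup C] [Module A C] (f : C →ₗ[A] A) (M : Type*)
    [AddCommGroup M] [Module Aᵐᵒᵖ M] : BalTensor A M C →+ M :=
  lift' (fun m c => op (f c) • m) (fun _ _ _ => smul_add _ _ _)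
    (fun _ _ _ => by rw [map_add, op_add, add_smul])
    (fun d a e => by rw [map_smul, smul_eq_mul, op_mul, mul_smul])

@[simp] theorem actMap_tmul {A C M : Type*} [Ring A] [AddCommGroup C] [Module A C]
    (f : C →ₗ[A] A) [AddCommGroup M] [Module Aᵐᵒᵖ M] (m : M) (c : C) :
    actMap f M (tmul A m c) = op (f c) • m :=
  rfl

/-- The coproduct as a left `A`-linear map. -/
def Coring.comulL [Coring A C] : C →ₗ[A] BalTensor A C C :=
  ⟨⟨comul, map_add comul⟩, comul_smul⟩

/-- The coproduct as a right `A`-linear map. -/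
def Coring.comulR [Coring A C] : C →ₗ[Aᵐᵒᵖ] BalTensor A C C :=
  ⟨⟨comul, map_add comul⟩, comul_op_smul⟩

/-- A right comodule structure over the `A`-coring `C` on a right `A`-module `M`: a coassociative,
counital, right `A`-linear coaction `M → M ⊗_A C`. -/
class RightComodule [Coring A C] (M : Type*) [AddCommGroup M] [Module Aᵐᵒᵖ M] where
  coact : M →ₗ[Aᵐᵒᵖ] BalTensor A M C
  coassoc : ∀ m : M,
    assoc (map coact LinearMap.id (coact m)) = map LinearMap.id (Coring.comulL A C) (coact m)
  counit : ∀ m : M, actMap (Coring.counit : C →ₗ[A] A) M (coact m) = m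

variable [Coring A C]

/-- The coring itself, as a right comodule via its coproduct. -/
instance : RightComodule A C C where
  coact := Coring.comulR A C
  coassoc := Coring.coassoc
  counit := Coring.counit_right

/-- The coaction `M → M ⊗_A C`. -/
abbrev coact {M : Type*} [AddCommGroup M] [Module Aᵐᵒᵖ M] [RightComodule A C M] :
    M →ₗ[Aᵐᵒᵖ] BalTensor A M C :=
  RightComodule.coact

/-- The group `Hom^C(M, N)` of right `C`-comodule maps. -/
def comoduleHom (M N : Type*) [AddCommGroup M] [Module Aᵐᵒᵖ M] [RightComodule A C M]
    [AddCommGroup N] [Module Aᵐᵒᵖ N] [RightComodule A C N] : AddSubgroup (M →ₗ[Aᵐᵒᵖ] N) where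
  carrier := {f | ∀ m, coact A C (f m) = map f LinearMap.id (coact A C m)}
  zero_mem' m := by simp [map_zero_left]
  add_mem' {f g} hf hg m := by
    rw [map_add_left, ← hf m, ← hg m, LinearMap.add_apply, _root_.map_add]
  neg_mem' {f} hf m := by
    have h := map_add_left f (-f) (LinearMap.id : C →ₗ[A] C) (coact A C m)
    rw [add_neg_cancel, map_zero_left, ← hf m] at h
    rw [LinearMap.neg_apply, _root_.map_neg]
    exact (eq_neg_of_add_eq_zero_right h.symm).symm

/-- The ring `T = End^C(M)` of comodule endomorphisms, with composition as multiplication. It acts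
on `M` from the left by evaluation. -/
def comodEnd (M : Type*) [AddCommGroup M] [Module Aᵐᵒᵖ M] [RightComodule A C M] :
    Subring (Module.End Aᵐᵒᵖ M) where
  __ := comoduleHom A C M M
  one_mem' m := (map_id _).symm
  mul_mem' {f g} hf hg m := by
    have h := map_comp f (LinearMap.id : C →ₗ[A] C) g (LinearMap.id : C →ₗ[A] C) (coact A C m)
    rw [LinearMap.comp_id] at h
    exact (hf (g m)).trans ((congrArg _ (hg m)).trans h.symm)

/-! ### The ring structure of the left dual and its action on comodules -/

variable {A C}

/-- The element `x · f = x⁽⁰⁾ f(x⁽¹⁾)` of a comodule `M`, for `x ∈ M` and `f ∈ *C`. -/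
def comoduleAct (M : Type*) [AddCommGroup M] [Module Aᵐᵒᵖ M] [RightComodule A C M]
    (f : LeftDual A C) : M →+ M :=
  (actMap f.toLin M).comp (coact A C : M →ₗ[Aᵐᵒᵖ] BalTensor A M C).toAddMonoidHom

theorem comoduleAct_add (M : Type*) [AddCommGroup M] [Module Aᵐᵒᵖ M] [RightComodule A C M]
    (f g : LeftDual A C) (x : M) :
    comoduleAct M (f + g) x = comoduleAct M f x + comoduleAct M g x :=
  hom_ext_apply (f := actMap (f + g).toLin M) (g := actMap f.toLin M + actMap g.toLin M)
    (fun m c => by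
      change op ((f + g) c) • m = op (f c) • m + op (g c) • m
      rw [LeftDual.add_apply, op_add, add_smul]) _

theorem comoduleAct_zero (M : Type*) [AddCommGroup M] [Module Aᵐᵒᵖ M] [RightComodule A C M]
    (x : M) : comoduleAct M (0 : LeftDual A C) x = 0 :=
  hom_ext_apply (f := actMap (0 : LeftDual A C).toLin M) (g := 0)
    (fun m c => by
      change op ((0 : LeftDual A C) c) • m = 0
      rw [LeftDual.zero_apply, op_zero, zero_smul]) _

/-- The map `c ↦ c⁽¹⁾ f(c⁽²⁾)` is left `A`-linear. -/
theorem comoduleAct_smul (f : LeftDual A C) (a : A) (c : C) :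
    comoduleAct C f (a • c) = a • comoduleAct C f c := by
  change actMap f.toLin C (Coring.comul (a • c)) = a • actMap f.toLin C (Coring.comul c)
  rw [Coring.comul_smul]
  exact map_left_smul (actMap f.toLin C) (fun a m c => (smul_comm a (op (f c)) m).symm) a _

/-- The multiplication `(f f')(c) = f'(c⁽¹⁾ f(c⁽²⁾))` of `*C`. -/
instance : Mul (LeftDual A C) where
  mul f f' :=
    ({ toFun := fun c => f' (comoduleAct C f c)
       map_add' := fun c d => by rw [_root_.map_add, LeftDual.map_add]
       map_smul' := fun a c => by
        rw [comoduleAct_smul, LeftDual.map_smul]; rfl } : C →ₗ[A] A)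

/-- The unit of `*C` is the counit of the coring. -/
instance : One (LeftDual A C) where
  one := (Coring.counit : C →ₗ[A] A)

theorem LeftDual.mul_apply (f f' : LeftDual A C) (c : C) :
    (f * f') c = f' (comoduleAct C f c) := rfl

theorem LeftDual.one_apply (c : C) : (1 : LeftDual A C) c = Coring.counit c := rfl

theorem comoduleAct_one (M : Type*) [AddCommGroup M] [Module Aᵐᵒᵖ M] [RightComodule A C M]
    (x : M) : comoduleAct M (1 : LeftDual A C) x = x :=
  RightComodule.counit x

/-- The map `C ⊗_A C → C`, `c ⊗ d ↦ c · f(d)`, is left `A`-linear. -/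
def actMapL (f : LeftDual A C) : BalTensor A C C →ₗ[A] C where
  __ := actMap f.toLin C
  map_smul' := map_left_smul (actMap f.toLin C) fun a m c => (smul_comm a (op (f c)) m).symm

/-- The left `A`-linear map `C → C`, `c ↦ c⁽¹⁾ f(c⁽²⁾)`. -/
def comoduleActL (f : LeftDual A C) : C →ₗ[A] C where
  __ := comoduleAct C f
  map_smul' := comoduleAct_smul f

/-- The coaction of `m⁽⁰⁾ f(m⁽¹⁾)` is `m⁽⁰⁾ ⊗ m⁽¹⁾ f(m⁽²⁾)`. -/
theorem coact_comoduleAct (M : Type*) [AddCommGroup M] [Module Aᵐᵒᵖ M] [RightComodule A C M]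
    (f : LeftDual A C) (x : M) :
    coact A C (comoduleAct M f x) = map LinearMap.id (comoduleActL f) (coact A C x) := by
  have key : ∀ z : BalTensor A (BalTensor A M C) C,
      actMap f.toLin (BalTensor A M C) z = map LinearMap.id (actMapL f) (assoc z) := by
    intro z
    refine hom_ext_apply (f := actMap f.toLin (BalTensor A M C)) (g := AddMonoidHom.comp
      (map LinearMap.id (actMapL f)) assoc.toAddMonoidHom) (fun w c => ?_) z
    induction w using BalTensor.induction with
    | zero => rw [zero_tmul, _root_.map_zero, _root_.map_zero]
    | tmul m d => rfl
    | add u v hu hv => rw [add_tmul, _root_.map_add, _root_.map_add, hu, hv]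
  have lin : ∀ z : BalTensor A M C, coact A C (actMap f.toLin M z) =
      actMap f.toLin (BalTensor A M C) (map (coact A C) LinearMap.id z) := fun z =>
    hom_ext_apply (f := (coact A C : M →ₗ[Aᵐᵒᵖ] BalTensor A M C).toAddMonoidHom.comp
        (actMap f.toLin M))
      (g := (actMap f.toLin (BalTensor A M C)).comp (map (coact A C) LinearMap.id))
      (fun m c => LinearMap.map_smul _ (op (f c)) m) z
  change coact A C (actMap f.toLin M (coact A C x)) = _
  rw [lin, key, RightComodule.coassoc, ← map_comp]
  rfl

theorem comoduleAct_mul (M : Type*) [AddCommGroup M] [Module Aᵐᵒᵖ M] [RightComodule A C M]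
    (f f' : LeftDual A C) (x : M) :
    comoduleAct M (f * f') x = comoduleAct M f' (comoduleAct M f x) := by
  change _ = actMap f'.toLin M (coact A C (comoduleAct M f x))
  rw [coact_comoduleAct]
  exact hom_ext_apply (f := actMap (f * f').toLin M) (g := (actMap f'.toLin M).comp
    (map LinearMap.id (comoduleActL f))) (fun m c => rfl) (coact A C x)

/-- The action of `*C` on comodules is compatible with the right `A`-action on `*C`. -/
theorem comoduleAct_op_smul (M : Type*) [AddCommGroup M] [Module Aᵐᵒᵖ M] [RightComodule A C M]
    (a : Aᵐᵒᵖ) (f : LeftDual A C) (x : M) :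
    comoduleAct M (a • f) x = a • comoduleAct M f x :=
  hom_ext_apply (f := actMap (a • f).toLin M)
    (g := (DistribSMul.toAddMonoidHom M a).comp (actMap f.toLin M))
    (fun m c => by
      change op (f c * a.unop) • m = a • op (f c) • m
      rw [op_mul, op_unop, mul_smul]) (coact A C x)

/-- Comodule maps are `*C`-linear. -/
theorem map_comoduleAct {M N : Type*} [AddCommGroup M] [Module Aᵐᵒᵖ M] [RightComodule A C M]
    [AddCommGroup N] [Module Aᵐᵒᵖ N] [RightComodule A C N] (t : M →ₗ[Aᵐᵒᵖ] N)
    (ht : t ∈ comoduleHom A C M N) (f : LeftDual A C) (x : M) :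
    t (comoduleAct M f x) = comoduleAct N f (t x) := by
  change _ = actMap f.toLin N (coact A C (t x))
  rw [ht x]
  exact hom_ext_apply (f := t.toAddMonoidHom.comp (actMap f.toLin M))
    (g := (actMap f.toLin N).comp (map t LinearMap.id))
    (fun m c => LinearMap.map_smul t (op (f c)) m) (coact A C x)

/-- The ring `*C`. -/
instance : Ring (LeftDual A C) where
  __ := (inferInstance : AddCommGroup (LeftDual A C))
  __ := (inferInstance : Mul (LeftDual A C))
  __ := (inferInstance : One (LeftDual A C))
  left_distrib f g h := by
    ext c; rfl
  right_distrib f g h := by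
    ext c
    rw [LeftDual.mul_apply, comoduleAct_add, LeftDual.map_add]; rfl
  zero_mul f := by
    ext c
    rw [LeftDual.mul_apply, comoduleAct_zero, LeftDual.map_zero]; rfl
  mul_zero f := by
    ext c; rfl
  mul_assoc f g h := by
    ext c
    rw [LeftDual.mul_apply, LeftDual.mul_apply, LeftDual.mul_apply, comoduleAct_mul]
  one_mul f := by
    ext c
    rw [LeftDual.mul_apply, comoduleAct_one]
  mul_one f := by
    ext c
    change Coring.counit (actMap f.toLin C (Coring.comul c)) = f c
    refine (hom_ext_apply (f := (Coring.counit : C →ₗ[A] A).toAddMonoidHom.comp (actMap f.toLin C))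
      (g := f.toLin.toAddMonoidHom.comp (lift' (fun (d e : C) => Coring.counit (A := A) d • e)
        (fun _ _ _ => by rw [_root_.map_add, add_smul]) (fun _ _ _ => smul_add _ _ _)
        (fun d a e => by rw [Coring.counit_op_smul, op_smul_eq_mul, mul_smul])))
      (fun d e => by
        change Coring.counit (op (f e) • d) = f (Coring.counit (A := A) d • e)
        rw [Coring.counit_op_smul, LeftDual.map_smul, op_smul_eq_mul]) (Coring.comul c)).trans ?_
    exact congrArg f (Coring.counit_left c)

/-- Every right `C`-comodule is a right `*C`-module by `x · f = x⁽⁰⁾ f(x⁽¹⁾)`. -/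
instance comoduleModule (M : Type*) [AddCommGroup M] [Module Aᵐᵒᵖ M] [RightComodule A C M] :
    Module (LeftDual A C)ᵐᵒᵖ M where
  smul f x := comoduleAct M f.unop x
  one_smul x := comoduleAct_one M x
  mul_smul f g x := comoduleAct_mul M g.unop f.unop x
  smul_zero _ := map_zero _
  smul_add _ := map_add _
  add_smul f g x := comoduleAct_add M f.unop g.unop x
  zero_smul x := comoduleAct_zero M x

/-! ### The bimodule `Q` -/

variable (A C)

section Sigma

variable (X : Type*) [AddCommGroup X] [Module Aᵐᵒᵖ X] [RightComodule A C X]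

variable {A C X} in
/-- The map `X ⊗_A C → C`, `x ⊗ d ↦ q(x)(c) d`. -/
def qMap (q : X →ₗ[Aᵐᵒᵖ] LeftDual A C) (c : C) : BalTensor A X C →+ C :=
  lift' (fun (y : X) (d : C) => q y c • d)
    (fun y y' d => by rw [_root_.map_add, LeftDual.add_apply, add_smul])
    (fun _ _ _ => smul_add _ _ _)
    (fun y a d => by rw [_root_.map_smul, LeftDual.op_smul_apply, unop_op, mul_smul])

/-- The group `Q` of right `A`-linear maps `q : X → *C` such that
`q(x⁽⁰⁾)(c) x⁽¹⁾ = c⁽¹⁾ q(x)(c⁽²⁾)` for all `x ∈ X` and `c ∈ C`. -/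
def moritaQ : AddSubgroup (X →ₗ[Aᵐᵒᵖ] LeftDual A C) where
  carrier := {q | ∀ (x : X) (c : C), qMap q c (coact A C x) = comoduleAct C (q x) c}
  zero_mem' x c := by
    refine Eq.trans ?_ (comoduleAct_zero C c).symm
    exact hom_ext_apply (f := qMap 0 c) (g := 0) (fun y d => (zero_smul A d : (0 : A) • d = 0)) _
  add_mem' {q q'} hq hq' x c := by
    refine Eq.trans ?_ (comoduleAct_add C (q x) (q' x) c).symm
    rw [← hq x c, ← hq' x c]
    exact hom_ext_apply (f := qMap (q + q') c) (g := qMap q c + qMap q' c)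
      (fun y d => (add_smul (q y c) (q' y c) d)) _
  neg_mem' {q} hq x c := by
    have h := comoduleAct_add C (q x) (-q x) c
    rw [add_neg_cancel, comoduleAct_zero, ← hq x c] at h
    refine Eq.trans ?_ (eq_neg_of_add_eq_zero_right h.symm).symm
    exact hom_ext_apply (f := qMap (-q) c) (g := -qMap q c)
      (fun y d => (neg_smul (q y c) d)) _

variable {A C X}

/-- Elements of `Q` are right `*C`-linear. -/
theorem moritaQ_comoduleAct (q : moritaQ A C X) (f : LeftDual A C) (x : X) :
    q.1 (comoduleAct X f x) = q.1 x * f := by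
  ext c
  rw [LeftDual.mul_apply, ← q.2 x c]
  refine hom_ext_apply (f := AddMonoidHom.mk' (fun w => q.1 (actMap f.toLin X w) c) ?_)
    (g := f.toLin.toAddMonoidHom.comp (qMap q.1 c)) (fun y d => ?_) (coact A C x)
  · intro w w'
    rw [_root_.map_add, _root_.map_add, LeftDual.add_apply]
  · change q.1 (op (f d) • y) c = f (q.1 y c • d)
    rw [_root_.map_smul, LeftDual.op_smul_apply, LeftDual.map_smul, unop_op]

/-- The left `*C`-action `(f q)(x) = f q(x)` on `Q`. -/
instance : Module (LeftDual A C) (moritaQ A C X) where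
  smul f q := ⟨⟨⟨fun x => f * q.1 x, fun x y => by rw [_root_.map_add, mul_add]⟩,
      fun a x => congrArg (f * ·) (_root_.map_smul q.1 a x)⟩, fun x c => by
    change _ = comoduleAct C (f * q.1 x) c
    rw [comoduleAct_mul]
    exact q.2 x (comoduleAct C f c)⟩
  one_smul q := Subtype.ext (LinearMap.ext fun x => one_mul (q.1 x))
  mul_smul f g q := Subtype.ext (LinearMap.ext fun x => mul_assoc f g (q.1 x))
  smul_zero f := Subtype.ext (LinearMap.ext fun _ => mul_zero f)
  smul_add f q q' := Subtype.ext (LinearMap.ext fun x => mul_add f (q.1 x) (q'.1 x))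
  add_smul f g q := Subtype.ext (LinearMap.ext fun x => add_mul f g (q.1 x))
  zero_smul q := Subtype.ext (LinearMap.ext fun x => zero_mul (q.1 x))

/-- The right `T`-action `(q t)(x) = q(t(x))` on `Q`, where `T = End^C(X)`. -/
instance : Module (comodEnd A C X)ᵐᵒᵖ (moritaQ A C X) where
  smul t q := ⟨q.1 ∘ₗ t.unop.1, fun x c => by
    change _ = comoduleAct C (q.1 (t.unop.1 x)) c
    rw [← q.2, t.unop.2 x]
    exact hom_ext_apply (f := qMap (q.1 ∘ₗ t.unop.1) c)
      (g := (qMap q.1 c).comp (map t.unop.1 LinearMap.id)) (fun _ _ => rfl) _⟩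
  one_smul q := rfl
  mul_smul s t q := rfl
  smul_zero t := rfl
  smul_add t q q' := rfl
  add_smul s t q := Subtype.ext (LinearMap.ext fun x => _root_.map_add q.1 (s.unop.1 x) (t.unop.1 x))
  zero_smul q := Subtype.ext (LinearMap.ext fun _ => _root_.map_zero q.1)

instance : SMulCommClass (LeftDual A C) (comodEnd A C X)ᵐᵒᵖ (moritaQ A C X) where
  smul_comm _ _ _ := rfl

instance : SMulCommClass (comodEnd A C X) (LeftDual A C)ᵐᵒᵖ X where
  smul_comm t f x := map_comoduleAct t.1 t.2 f.unop x

/-- For `w = ∑ m ⊗ c ∈ M ⊗_A C` and `q : X → *C`, the map `X → M`, `y ↦ ∑ m q(y)(c)`. -/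
def actLin (q : X →ₗ[Aᵐᵒᵖ] LeftDual A C) {M : Type*} [AddCommGroup M] [Module Aᵐᵒᵖ M]
    (w : BalTensor A M C) : X →ₗ[Aᵐᵒᵖ] M where
  toFun y := actMap (q y).toLin M w
  map_add' y y' := hom_ext_apply (f := actMap (q (y + y')).toLin M)
    (g := actMap (q y).toLin M + actMap (q y').toLin M) (fun m c => by
      change op (q (y + y') c) • m = op (q y c) • m + op (q y' c) • m
      rw [_root_.map_add, LeftDual.add_apply, op_add, add_smul]) w
  map_smul' a y := hom_ext_apply (f := actMap (q (a • y)).toLin M)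
    (g := (DistribSMul.toAddMonoidHom M a).comp (actMap (q y).toLin M)) (fun m c => by
      change op (q (a • y) c) • m = a • op (q y c) • m
      rw [_root_.map_smul, LeftDual.op_smul_apply, op_mul, op_unop, mul_smul]) w

theorem actLin_mem (q : moritaQ A C X) {M : Type*} [AddCommGroup M] [Module Aᵐᵒᵖ M]
    [RightComodule A C M] (m : M) : actLin q.1 (coact A C m) ∈ comoduleHom A C X M := by
  intro y
  change coact A C (comoduleAct M (q.1 y) m) = _
  rw [coact_comoduleAct]
  generalize coact A C m = w
  induction w using BalTensor.induction with
  | zero =>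
    have : actLin q.1 (0 : BalTensor A M C) = 0 := LinearMap.ext fun y => _root_.map_zero (actMap (q.1 y).toLin M)
    rw [this, map_zero_left, _root_.map_zero]
  | tmul m c =>
    change tmul A m (comoduleAct C (q.1 y) c) = _
    rw [← q.2 y c]
    refine hom_ext_apply (f := AddMonoidHom.mk' (fun z => tmul A m (qMap q.1 c z)) ?_)
      (g := map (actLin q.1 (tmul A m c)) LinearMap.id) (fun x d => ?_) (coact A C y)
    · intro z z'
      rw [_root_.map_add, tmul_add]
    · change tmul A m (q.1 x c • d) = tmul A (op (q.1 x c) • m) d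
      rw [smul_tmul]
  | add u v hu hv =>
    have : actLin q.1 (u + v) = actLin q.1 u + actLin q.1 v :=
      LinearMap.ext fun y => _root_.map_add (actMap (q.1 y).toLin M) u v
    rw [_root_.map_add, hu, hv, this, map_add_left]

end Sigma

end Coring

/-! ### Morita contexts -/

section Morita

open BalTensor

/-- A Morita context connecting the rings `T` and `S`: a `T`-`S` bimodule `P`, an `S`-`T` bimodule
`Q`, and bimodule maps `Q ⊗_T P → S` and `P ⊗_S Q → T` satisfying the two associativity laws. -/
structure MoritaContext (T S P Q : Type*) [Ring T] [Ring S] [AddCommGroup P] [AddCommGroup Q]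
    [Module T P] [Module Sᵐᵒᵖ P] [SMulCommClass T Sᵐᵒᵖ P]
    [Module S Q] [Module Tᵐᵒᵖ Q] [SMulCommClass S Tᵐᵒᵖ Q] where
  /-- The connecting map `Q ⊗_T P → S`. -/
  toS : BalTensor T Q P →+ S
  /-- The connecting map `P ⊗_S Q → T`. -/
  toT : BalTensor S P Q →+ T
  toS_smul : ∀ (s : S) z, toS (s • z) = s • toS z
  toS_op_smul : ∀ (s : Sᵐᵒᵖ) z, toS (s • z) = s • toS z
  toT_smul : ∀ (t : T) z, toT (t • z) = t • toT z
  toT_op_smul : ∀ (t : Tᵐᵒᵖ) z, toT (t • z) = t • toT z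
  assoc_P : ∀ (p : P) (q : Q) (p' : P), toT (tmul S p q) • p' = op (toS (tmul T q p')) • p
  assoc_Q : ∀ (q : Q) (p : P) (q' : Q), toS (tmul T q p) • q' = op (toT (tmul S p q')) • q

/-- A Morita context is strict if both connecting maps are isomorphisms. -/
def MoritaContext.IsStrict {T S P Q : Type*} [Ring T] [Ring S] [AddCommGroup P] [AddCommGroup Q]
    [Module T P] [Module Sᵐᵒᵖ P] [SMulCommClass T Sᵐᵒᵖ P]
    [Module S Q] [Module Tᵐᵒᵖ Q] [SMulCommClass S Tᵐᵒᵖ Q] (m : MoritaContext T S P Q) : Prop :=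
  Function.Bijective m.toS ∧ Function.Bijective m.toT

variable (A : Type*) (C : Type*) [Ring A] [AddCommGroup C] [Module A C] [Module Aᵐᵒᵖ C]
  [SMulCommClass A Aᵐᵒᵖ C] [Coring A C]
  (X : Type*) [AddCommGroup X] [Module Aᵐᵒᵖ X] [RightComodule A C X]

/-- The Morita context `(T, *C, X, Q)` of a comodule `X`, with connecting maps
`q ⊗ x ↦ q(x)` and `x ⊗ q ↦ (y ↦ x · q(y) = x⁽⁰⁾ q(y)(x⁽¹⁾))`. -/
def moritaContext :
    MoritaContext (comodEnd A C X) (LeftDual A C) X (moritaQ A C X) where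
  toS := lift' (fun (q : moritaQ A C X) (x : X) => q.1 x) (fun _ _ _ => rfl)
    (fun q _ _ => _root_.map_add q.1 _ _) (fun _ _ _ => rfl)
  toT := lift' (fun (x : X) (q : moritaQ A C X) =>
      (⟨actLin q.1 (coact A C x), actLin_mem q x⟩ : comodEnd A C X))
    (fun x x' q => Subtype.ext (LinearMap.ext fun y => _root_.map_add (comoduleAct X (q.1 y)) x x'))
    (fun x q q' => Subtype.ext (LinearMap.ext fun y => comoduleAct_add X (q.1 y) (q'.1 y) x))
    (fun x f q => Subtype.ext (LinearMap.ext fun y => (comoduleAct_mul X f (q.1 y) x).symm))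
  toS_smul := map_left_smul _ fun _ _ _ => rfl
  toS_op_smul := map_right_smul _ fun f q x => moritaQ_comoduleAct q f.unop x
  toT_smul := map_left_smul _ fun t x q => Subtype.ext (LinearMap.ext fun y =>
    (map_comoduleAct t.1 t.2 (q.1 y) x).symm)
  toT_op_smul := map_right_smul _ fun _ _ _ => rfl
  assoc_P _ _ _ := rfl
  assoc_Q q x q' := Subtype.ext (LinearMap.ext fun y => (moritaQ_comoduleAct q (q'.1 y) x).symm)

end Morita

/-! ### Galois comodules and faithful flatness -/

section Galois

open BalTensor

variable {A : Type*} {C : Type*} [Ring A] [AddCommGroup C] [Module A C] [Module Aᵐᵒᵖ C]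
  [SMulCommClass A Aᵐᵒᵖ C] [Coring A C]

/-- The right `T`-action `(f t)(x) = f(t(x))` on `Hom_A(X, N)`, where `T = End^C(X)`. -/
instance homModule {X : Type*} [AddCommGroup X] [Module Aᵐᵒᵖ X] [RightComodule A C X] {N : Type*}
    [AddCommGroup N] [Module Aᵐᵒᵖ N] : Module (comodEnd A C X)ᵐᵒᵖ (X →ₗ[Aᵐᵒᵖ] N) where
  smul t f := f ∘ₗ t.unop.1
  one_smul _ := rfl
  mul_smul _ _ _ := rfl
  smul_zero _ := rfl
  smul_add _ _ _ := rfl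
  add_smul s t f := LinearMap.ext fun x => _root_.map_add f (s.unop.1 x) (t.unop.1 x)
  zero_smul f := LinearMap.ext fun _ => _root_.map_zero f

variable (A C)

/-- The canonical map `Hom_A(X, N) ⊗_T X → N ⊗_A C`, `φ ⊗ x ↦ φ(x⁽⁰⁾) ⊗ x⁽¹⁾`. -/
def can (X : Type*) [AddCommGroup X] [Module Aᵐᵒᵖ X] [RightComodule A C X] (N : Type*)
    [AddCommGroup N] [Module Aᵐᵒᵖ N] :
    BalTensor (comodEnd A C X) (X →ₗ[Aᵐᵒᵖ] N) X →+ BalTensor A N C :=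
  lift' (fun (φ : X →ₗ[Aᵐᵒᵖ] N) (x : X) => map φ LinearMap.id (coact A C x))
    (fun _ _ _ => map_add_left _ _ _ _)
    (fun _ _ _ => by rw [_root_.map_add, _root_.map_add])
    (fun φ t x => by
      change _ = map φ LinearMap.id (coact A C (t.1 x))
      rw [t.2 x, ← map_comp]
      rfl)

variable {A C}

/-- The composite of two comodule maps. -/
def comoduleHomComp {M N P : Type*} [AddCommGroup M] [Module Aᵐᵒᵖ M] [RightComodule A C M]
    [AddCommGroup N] [Module Aᵐᵒᵖ N] [RightComodule A C N]
    [AddCommGroup P] [Module Aᵐᵒᵖ P] [RightComodule A C P]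
    (f : comoduleHom A C M N) (g : comoduleHom A C N P) : comoduleHom A C M P :=
  ⟨g.1 ∘ₗ f.1, fun m => by
    change coact A C (g.1 (f.1 m)) = _
    rw [g.2, f.2, ← map_comp]
    rfl⟩

/-- The right `T`-module `Hom^C(X, M)`, with action `(φ t)(x) = φ(t(x))`. -/
instance comoduleHomModule {X : Type*} [AddCommGroup X] [Module Aᵐᵒᵖ X] [RightComodule A C X]
    {M : Type*} [AddCommGroup M] [Module Aᵐᵒᵖ M] [RightComodule A C M] :
    Module (comodEnd A C X)ᵐᵒᵖ (comoduleHom A C X M) where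
  smul t φ := comoduleHomComp (M := X) ⟨t.unop.1, t.unop.2⟩ φ
  one_smul _ := rfl
  mul_smul _ _ _ := rfl
  smul_zero _ := rfl
  smul_add _ _ _ := rfl
  add_smul s t φ := Subtype.ext (LinearMap.ext fun x =>
    _root_.map_add φ.1 (s.unop.1 x) (t.unop.1 x))
  zero_smul φ := Subtype.ext (LinearMap.ext fun _ => _root_.map_zero φ.1)

variable {X : Type*} [AddCommGroup X] [Module Aᵐᵒᵖ X] [RightComodule A C X]
  {N : Type*} [AddCommGroup N] [Module (comodEnd A C X)ᵐᵒᵖ N]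

/-- For `n ∈ N`, the right `A`-linear map `X → N ⊗_T X`, `x ↦ n ⊗ x`. -/
def tmulLin (A C X : Type*) [Ring A] [AddCommGroup C] [Module A C] [Module Aᵐᵒᵖ C]
    [SMulCommClass A Aᵐᵒᵖ C] [Coring A C] [AddCommGroup X] [Module Aᵐᵒᵖ X] [RightComodule A C X]
    {N : Type*} [AddCommGroup N] [Module (comodEnd A C X)ᵐᵒᵖ N] (n : N) :
    X →ₗ[Aᵐᵒᵖ] BalTensor (comodEnd A C X) N X where
  toFun x := tmul (comodEnd A C X) n x
  map_add' := tmul_add n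
  map_smul' _ _ := rfl

theorem tmulLin_add (n n' : N) :
    (tmulLin A C X (n + n') : X →ₗ[Aᵐᵒᵖ] BalTensor (comodEnd A C X) N X) =
    tmulLin A C X n + tmulLin A C X n' :=
  LinearMap.ext fun x => add_tmul n n' x

theorem tmulLin_smul (n : N) (t : comodEnd A C X) :
    (tmulLin A C X (op t • n) : X →ₗ[Aᵐᵒᵖ] BalTensor (comodEnd A C X) N X) = tmulLin A C X n ∘ₗ t.1 :=
  LinearMap.ext fun x => smul_tmul n t x

/-- The coaction `n ⊗ x ↦ (n ⊗ x⁽⁰⁾) ⊗ x⁽¹⁾` on `N ⊗_T X`. -/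
def tensorCoact : BalTensor (comodEnd A C X) N X →ₗ[Aᵐᵒᵖ]
    BalTensor A (BalTensor (comodEnd A C X) N X) C where
  __ := lift' (fun (n : N) (x : X) => map (tmulLin A C X n) (LinearMap.id : C →ₗ[A] C) (coact A C x))
    (fun n n' x => by rw [tmulLin_add, map_add_left])
    (fun _ _ _ => by rw [_root_.map_add, _root_.map_add])
    (fun n t x => by
      rw [tmulLin_smul]
      change _ = map _ _ (coact A C (t.1 x))
      rw [t.2 x, ← map_comp]
      rfl)
  map_smul' := map_right_smul (lift' _ _ _ _) fun a n x => by
    change map _ _ (coact A C (a • x)) = a • map _ _ (coact A C x)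
    rw [_root_.map_smul]
    exact (rTensor (S := A) C (tmulLin A C X n)).map_smul a _

theorem tensorCoact_tmul (n : N) (x : X) :
    tensorCoact (A := A) (C := C) (tmul (comodEnd A C X) n x) =
      map (tmulLin A C X n) LinearMap.id (coact A C x) :=
  rfl

/-- The right `C`-comodule `N ⊗_T X`. -/
instance tensorComodule : RightComodule A C (BalTensor (comodEnd A C X) N X) where
  coact := tensorCoact
  coassoc z := by
    refine hom_ext_apply (f := (assoc.toAddMonoidHom.comp
        (map (tensorCoact (N := N)) LinearMap.id)).comp
        (tensorCoact (A := A) (C := C) (X := X) (N := N)).toAddMonoidHom)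
      (g := (map LinearMap.id (Coring.comulL A C)).comp
        (tensorCoact (A := A) (C := C) (X := X) (N := N)).toAddMonoidHom)
      (fun n x => ?_) z
    change assoc (map (tensorCoact (N := N)) LinearMap.id
        (map (tmulLin A C X n) LinearMap.id (coact A C x))) =
      map LinearMap.id (Coring.comulL A C) (map (tmulLin A C X n) LinearMap.id (coact A C x))
    have h : map LinearMap.id (Coring.comulL A C) (map (tmulLin A C X n) LinearMap.id (coact A C x)) =
        map (tmulLin A C X n) LinearMap.id (map LinearMap.id (Coring.comulL A C) (coact A C x)) := by
      rw [← map_comp, ← map_comp]; rfl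
    have h' : map (tensorCoact (N := N)) LinearMap.id
        (map (tmulLin A C X n) LinearMap.id (coact A C x)) =
        map (rTensor (S := A) C (tmulLin A C X n)) (LinearMap.id : C →ₗ[A] C)
          (map (coact A C) LinearMap.id (coact A C x)) := by
      rw [← map_comp, ← map_comp]; rfl
    rw [h, h', ← RightComodule.coassoc]
    refine hom_ext_apply (f := assoc.toAddMonoidHom.comp
        (map (rTensor (S := A) C (tmulLin A C X n)) (LinearMap.id : C →ₗ[A] C)))
      (g := (map (tmulLin A C X n) LinearMap.id).comp assoc.toAddMonoidHom) (fun w c => ?_)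
      (map (coact A C) LinearMap.id (coact A C x))
    induction w using BalTensor.induction with
    | zero => rw [zero_tmul, _root_.map_zero, _root_.map_zero]
    | tmul y d => rfl
    | add u v hu hv => rw [add_tmul, _root_.map_add, _root_.map_add, hu, hv]
  counit z := by
    refine hom_ext_apply (f := (actMap (Coring.counit : C →ₗ[A] A) _).comp
      (tensorCoact (A := A) (C := C) (X := X) (N := N)).toAddMonoidHom) (g := AddMonoidHom.id _) (fun n x => ?_) z
    change actMap (Coring.counit : C →ₗ[A] A) _ (map (tmulLin A C X n) LinearMap.id (coact A C x)) =
      tmul _ n x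
    have h : ∀ w : BalTensor A X C, actMap (Coring.counit : C →ₗ[A] A) _
        (map (tmulLin A C X n) LinearMap.id w) =
        tmulLin A C X n (actMap (Coring.counit : C →ₗ[A] A) X w) := fun w =>
      hom_ext_apply (f := (actMap (Coring.counit : C →ₗ[A] A) _).comp
          (map (tmulLin A C X n) LinearMap.id))
        (g := (tmulLin A C X n).toAddMonoidHom.comp (actMap (Coring.counit : C →ₗ[A] A) X))
        (fun _ _ => rfl) w
    rw [h, RightComodule.counit]
    rfl

/-- `f ⊗_T X` is a comodule map, for every right `T`-linear map `f`. -/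
theorem rTensor_mem {N' : Type*} [AddCommGroup N'] [Module (comodEnd A C X)ᵐᵒᵖ N']
    (f : N →ₗ[(comodEnd A C X)ᵐᵒᵖ] N') :
    rTensor X f ∈ comoduleHom A C (BalTensor (comodEnd A C X) N X)
      (BalTensor (comodEnd A C X) N' X) := fun z =>
  hom_ext_apply (f := (tensorCoact (A := A) (C := C) (X := X) (N := N')).toAddMonoidHom.comp
      (rTensor (S := A) X f).toAddMonoidHom)
    (g := (map (rTensor X f) LinearMap.id).comp
      (tensorCoact (A := A) (C := C) (X := X)).toAddMonoidHom)
    (fun n x => by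
      change map (tmulLin A C X (f n)) LinearMap.id (coact A C x) =
        map (rTensor X f) LinearMap.id (map (tmulLin A C X n) LinearMap.id (coact A C x))
      rw [← map_comp]
      rfl) z

end Galois

/-- A comodule `X` is a Galois comodule if the canonical map
`Hom_A(X, N) ⊗_T X → N ⊗_A C` is bijective for every right `A`-module `N`. -/
def IsGaloisComodule (A C : Type u) [Ring A] [AddCommGroup C] [Module A C] [Module Aᵐᵒᵖ C]
    [SMulCommClass A Aᵐᵒᵖ C] [Coring A C] (X : Type u) [AddCommGroup X] [Module Aᵐᵒᵖ X]
    [RightComodule A C X] : Prop :=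
  ∀ (N : Type u) [AddCommGroup N] [Module Aᵐᵒᵖ N], Function.Bijective (can A C X N)

/-- A left `R`-module `P` is faithfully flat if a sequence of right `R`-modules is exact if and only
if it is exact after applying `- ⊗_R P`. -/
def IsFaithfullyFlat (R P : Type u) [Ring R] [AddCommGroup P] [Module R P] : Prop :=
  ∀ (N₁ N₂ N₃ : Type u) [AddCommGroup N₁] [AddCommGroup N₂] [AddCommGroup N₃]
    [Module Rᵐᵒᵖ N₁] [Module Rᵐᵒᵖ N₂] [Module Rᵐᵒᵖ N₃]
    (f : N₁ →ₗ[Rᵐᵒᵖ] N₂) (g : N₂ →ₗ[Rᵐᵒᵖ] N₃),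
    Function.Exact f g ↔ Function.Exact
      (BalTensor.map f (LinearMap.id : P →ₗ[R] P)) (BalTensor.map g (LinearMap.id : P →ₗ[R] P))

/-! ### The category of comodules and the two functors -/

section Category

open CategoryTheory

variable (A C : Type u) [Ring A] [AddCommGroup C] [Module A C] [Module Aᵐᵒᵖ C]
  [SMulCommClass A Aᵐᵒᵖ C] [Coring A C]

/-- The objects of the category of right `C`-comodules. -/
structure ComodCat where
  carrier : Type u
  [isAddCommGroup : AddCommGroup carrier]
  [isModule : Module Aᵐᵒᵖ carrier]
  [isComodule : RightComodule A C carrier]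

attribute [instance] ComodCat.isAddCommGroup ComodCat.isModule ComodCat.isComodule

/-- The category of right `C`-comodules and comodule maps. -/
instance : Category (ComodCat A C) where
  Hom M N := comoduleHom A C M.carrier N.carrier
  id M := ⟨LinearMap.id, (comodEnd A C M.carrier).one_mem⟩
  comp f g := comoduleHomComp f g
  id_comp _ := rfl
  comp_id _ := rfl
  assoc _ _ _ := rfl

variable (X : Type u) [AddCommGroup X] [Module Aᵐᵒᵖ X] [RightComodule A C X]

/-- The functor `- ⊗_T X : M_T ⥤ M^C`, where `T = End^C(X)`. -/
def tensorFunctor : ModuleCat.{u} (comodEnd A C X)ᵐᵒᵖ ⥤ ComodCat A C where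
  obj N := ⟨BalTensor (comodEnd A C X) N X⟩
  map f := ⟨BalTensor.rTensor X f.hom, rTensor_mem f.hom⟩
  map_id N := Subtype.ext (LinearMap.ext fun z => BalTensor.map_id z)
  map_comp f g := Subtype.ext (LinearMap.ext fun z =>
    BalTensor.map_comp g.hom LinearMap.id f.hom LinearMap.id z)

/-- The functor `Hom^C(X, -) : M^C ⥤ M_T`, where `T = End^C(X)`. -/
def homFunctor : ComodCat A C ⥤ ModuleCat.{u} (comodEnd A C X)ᵐᵒᵖ where
  obj M := ModuleCat.of _ (comoduleHom A C X M.carrier)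
  map g := ModuleCat.ofHom
    { toFun := fun φ => comoduleHomComp φ g
      map_add' := fun φ ψ => Subtype.ext (LinearMap.ext fun x =>
        _root_.map_add (Subtype.val g) (φ.1 x) (ψ.1 x))
      map_smul' := fun _ _ => rfl }

end Category

end CoringMorita

open CoringMorita

namespace CoringMorita

open BalTensor

/-! ### Finite sums of pure tensors. -/

namespace BalTensor

variable {R M N P : Type*} [Ring R] [AddCommGroup M] [Module Rᵐᵒᵖ M] [AddCommGroup N] [Module R N]
  [AddCommGroup P]

/-! The functor `- ⊗_T X` is left adjoint to `Hom^C(X, -)`, with unit `n ↦ (x ↦ n ⊗ x)` and counit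
`φ ⊗ x ↦ φ(x)`, so condition 3 says that `tensorUnit` and `tensorCounit` are bijective everywhere
(`exists_equivalence_iff`). The three conditions are then proved in a cycle.

Strictness gives two finite families of data: `∑ xᵢ qᵢ = 1` in `T` and `∑ qⱼ(xⱼ) = 1` in `*C`. By
the first, `y = ∑ xᵢ · qᵢ(y)`; expanding each `qᵢ(y)` in a dual basis of `*C` gives a finite dual
basis of `X` over `A`. Together the families make `X` faithfully flat over `T`: an element of `N ⊗_T
X` is contracted against `Q` to elements of `N` and rebuilt from them
(`MoritaContext.IsStrict.isFaithfullyFlat`). They also provide explicit inverses of unit and counit.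
Since `Hom_A(X, N) ≅ Hom^C(X, N ⊗_A C)`, the canonical map at `N` is the counit at the cofree
comodule `N ⊗_A C`, so bijectivity of the counit gives the Galois property.

If `X` is Galois and faithfully flat, present `Hom^C(X, M)` as the kernel of `Hom_A(X, M) → Hom_A(X,
M ⊗_A C)`, `φ ↦ ρφ - (φ ⊗ C)ρ`. Tensoring with `X` keeps the sequence exact, and the canonical maps
identify its last two terms with `M ⊗_A C → M ⊗_A C ⊗_A C`, in which the coaction embeds `M` in the
kernel. Hence the counit is bijective. The unit becomes bijective after `- ⊗_T X`, where the counit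
inverts it, so faithful flatness finishes.

Conversely, finite projectivity of `C` makes `*C` a right comodule whose comodule maps from `X`
belong to `Q`. Surjectivity of the counit at `*C` is then surjectivity of `Q ⊗_T X → *C`. That in
turn forces `(T/I) ⊗_T X = 0` for the image `I` of `X ⊗ Q → T`, and injectivity of the unit at `T/I`
yields `I = T`. In any Morita context, surjective connecting maps are injective. -/

theorem sum_tmul {ι : Type*} (s : Finset ι) (m : ι → M) (n : N) :
    tmul R (∑ i ∈ s, m i) n = ∑ i ∈ s, tmul R (m i) n :=
  _root_.map_sum (AddMonoidHom.mk' (fun m => tmul R m n) fun _ _ => add_tmul _ _ _) m s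

theorem tmul_sum {ι : Type*} (s : Finset ι) (m : M) (n : ι → N) :
    tmul R m (∑ i ∈ s, n i) = ∑ i ∈ s, tmul R m (n i) :=
  _root_.map_sum (AddMonoidHom.mk' (fun n => tmul R m n) fun _ _ => tmul_add _ _ _) n s

/-- Every element of a tensor product is a finite sum of pure tensors. -/
theorem exists_eq_sum_tmul (z : BalTensor R M N) :
    ∃ (k : ℕ) (m : Fin k → M) (n : Fin k → N), z = ∑ i, tmul R (m i) (n i) := by
  induction z using BalTensor.induction with
  | zero => exact ⟨0, fun _ => 0, fun _ => 0, by simp⟩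
  | tmul m n => exact ⟨1, fun _ => m, fun _ => n, by simp⟩
  | add x y hx hy =>
    obtain ⟨k, m, n, rfl⟩ := hx
    obtain ⟨k', m', n', rfl⟩ := hy
    exact ⟨k + k', Fin.append m m', Fin.append n n', by simp [Fin.sum_univ_add]⟩

end BalTensor

/-! ### Strict Morita contexts. -/

namespace MoritaContext

section

variable {T S P Q : Type*} [Ring T] [Ring S] [AddCommGroup P] [AddCommGroup Q]
  [Module T P] [Module Sᵐᵒᵖ P] [SMulCommClass T Sᵐᵒᵖ P]
  [Module S Q] [Module Tᵐᵒᵖ Q] [SMulCommClass S Tᵐᵒᵖ Q] (m : MoritaContext T S P Q)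

/-- On pure tensors, `p ⊗ q(p'q') = p ⊗ (qp')q' = p(qp') ⊗ q' = (pq)p' ⊗ q'`, using both
associativity laws. This is what turns surjectivity of a connecting map into injectivity. -/
theorem op_toT_smul (z w : BalTensor S P Q) : op (m.toT w) • z = m.toT z • w := by
  induction z using BalTensor.induction with
  | zero => simp
  | add x y hx hy => rw [smul_add, hx, hy, map_add, add_smul]
  | tmul p q =>
    induction w using BalTensor.induction with
    | zero => simp
    | add x y hx hy => rw [map_add, op_add, add_smul, hx, hy, smul_add]
    | tmul p' q' =>
      rw [right_smul_tmul, left_smul_tmul, ← m.assoc_Q, m.assoc_P, smul_tmul]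

theorem op_toS_smul (z w : BalTensor T Q P) : op (m.toS w) • z = m.toS z • w := by
  induction z using BalTensor.induction with
  | zero => simp
  | add x y hx hy => rw [smul_add, hx, hy, map_add, add_smul]
  | tmul p q =>
    induction w using BalTensor.induction with
    | zero => simp
    | add x y hx hy => rw [map_add, op_add, add_smul, hx, hy, smul_add]
    | tmul p' q' =>
      rw [right_smul_tmul, left_smul_tmul, ← m.assoc_P, m.assoc_Q, smul_tmul]

/-- A Morita context with surjective connecting maps is strict. -/
theorem isStrict_of_surjective (hS : Function.Surjective m.toS) (hT : Function.Surjective m.toT) :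
    m.IsStrict := by
  refine ⟨⟨(injective_iff_map_eq_zero _).2 fun z hz => ?_, hS⟩,
    ⟨(injective_iff_map_eq_zero _).2 fun z hz => ?_, hT⟩⟩
  -- With `toS w = 1` the exchange identity reads `z = toS z • w = 0`.
  · obtain ⟨w, hw⟩ := hS 1
    simpa [hw, hz] using m.op_toS_smul z w
  · obtain ⟨w, hw⟩ := hT 1
    simpa [hw, hz] using m.op_toT_smul z w

theorem exists_sum_toT_eq_one (hT : Function.Surjective m.toT) :
    ∃ (k : ℕ) (p : Fin k → P) (q : Fin k → Q), ∑ i, m.toT (tmul S (p i) (q i)) = 1 := by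
  obtain ⟨w, hw⟩ := hT 1
  obtain ⟨k, p, q, rfl⟩ := exists_eq_sum_tmul w
  exact ⟨k, p, q, by rw [← hw, map_sum]⟩

theorem exists_sum_toS_eq_one (hS : Function.Surjective m.toS) :
    ∃ (k : ℕ) (q : Fin k → Q) (p : Fin k → P), ∑ i, m.toS (tmul T (q i) (p i)) = 1 := by
  obtain ⟨w, hw⟩ := hS 1
  obtain ⟨k, q, p, rfl⟩ := exists_eq_sum_tmul w
  exact ⟨k, q, p, by rw [← hw, map_sum]⟩

variable {N N' : Type*} [AddCommGroup N] [Module Tᵐᵒᵖ N] [AddCommGroup N'] [Module Tᵐᵒᵖ N']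

/-- The map `N ⊗_T P → N`, `n ⊗ p ↦ n · (p q)`, for `q ∈ Q`. -/
def contract (N : Type*) [AddCommGroup N] [Module Tᵐᵒᵖ N] (q : Q) : BalTensor T N P →+ N :=
  lift' (fun n p => op (m.toT (tmul S p q)) • n) (fun _ _ _ => smul_add _ _ _)
    (fun _ _ _ => by rw [add_tmul, map_add, op_add, add_smul])
    (fun n t p => by
      rw [← left_smul_tmul, m.toT_smul, smul_eq_mul, op_mul, mul_smul])

theorem contract_tmul (q : Q) (n : N) (p : P) :
    m.contract N q (tmul T n p) = op (m.toT (tmul S p q)) • n :=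
  rfl

theorem contract_map (q : Q) (f : N →ₗ[Tᵐᵒᵖ] N') (z : BalTensor T N P) :
    m.contract N' q (map f LinearMap.id z) = f (m.contract N q z) :=
  hom_ext_apply (f := (m.contract N' q).comp (map f LinearMap.id))
    (g := f.toAddMonoidHom.comp (m.contract N q)) (fun n _ => (map_smul f _ n).symm) z

/-- A decomposition of `1 ∈ T` recovers elements of `N` from their images in `N ⊗_T P`. -/
theorem sum_contract_tmul {k : ℕ} {p : Fin k → P} {q : Fin k → Q}
    (h : ∑ i, m.toT (tmul S (p i) (q i)) = 1) (n : N) :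
    ∑ i, m.contract N (q i) (tmul T n (p i)) = n := by
  simp_rw [contract_tmul]
  rw [← Finset.sum_smul, ← Finset.op_sum, h, op_one, one_smul]

/-- Dually, a decomposition of `1 ∈ S` rebuilds a tensor from its contractions: `n(xqᵢ) ⊗ pᵢ = n ⊗
x(qᵢpᵢ)`, and the `qᵢpᵢ` sum to `1`. -/
theorem sum_tmul_contract {k : ℕ} {q : Fin k → Q} {p : Fin k → P}
    (h : ∑ i, m.toS (tmul T (q i) (p i)) = 1) (z : BalTensor T N P) :
    ∑ i, tmul T (m.contract N (q i) z) (p i) = z := by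
  induction z using BalTensor.induction with
  | zero => simp [zero_tmul]
  | add x y hx hy => simp only [map_add, add_tmul, Finset.sum_add_distrib, hx, hy]
  | tmul n x =>
    simp_rw [contract_tmul, smul_tmul, m.assoc_P]
    rw [← BalTensor.tmul_sum, ← Finset.sum_smul, ← Finset.op_sum, h, op_one, one_smul]

end

/-- In a strict Morita context the bimodule `P` is faithfully flat. -/
theorem IsStrict.isFaithfullyFlat {T P : Type u} {S Q : Type*} [Ring T] [Ring S] [AddCommGroup P]
    [AddCommGroup Q] [Module T P] [Module Sᵐᵒᵖ P] [SMulCommClass T Sᵐᵒᵖ P]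
    [Module S Q] [Module Tᵐᵒᵖ Q] [SMulCommClass S Tᵐᵒᵖ Q] {m : MoritaContext T S P Q}
    (hm : m.IsStrict) : IsFaithfullyFlat T P := by
  intro N₁ N₂ N₃ _ _ _ _ _ _ f g
  obtain ⟨k, p, q, h⟩ := m.exists_sum_toT_eq_one hm.2.2
  obtain ⟨l, q', p', h'⟩ := m.exists_sum_toS_eq_one hm.1.2
  have left_inv {N N' : Type u} [AddCommGroup N] [Module Tᵐᵒᵖ N] [AddCommGroup N']
      [Module Tᵐᵒᵖ N'] (e : N →ₗ[Tᵐᵒᵖ] N') (n : N)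
      (hn : ∀ i, map e LinearMap.id (tmul T n (p i)) = 0) : e n = 0 := by
    rw [← m.sum_contract_tmul h n, map_sum]
    exact Finset.sum_eq_zero fun i _ => by rw [← m.contract_map, hn, map_zero]
  refine ⟨fun hfg z => ⟨fun hz => ?_, ?_⟩, fun hfg n => ⟨fun hn => ?_, ?_⟩⟩
  -- The contractions of a cycle are cycles in `N₂`; they are lifted one by one and the lifts are
  -- tensored back with the `p'ᵢ`.
  · have hq (i) : ∃ n, f n = m.contract N₂ (q' i) z :=
      (hfg _).1 (by rw [← m.contract_map, hz, map_zero])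
    choose n hn using hq
    refine ⟨∑ i, tmul T (n i) (p' i), ?_⟩
    rw [map_sum, ← m.sum_tmul_contract h' z]
    exact Finset.sum_congr rfl fun i _ => by rw [map_tmul, hn]; rfl
  · rintro ⟨w, rfl⟩
    rw [← map_comp, hfg.linearMap_comp_eq_zero]
    exact map_zero_left _ _
  -- Here the roles are exchanged: each `n ⊗ pᵢ` is lifted, and the lifts are contracted and summed
  -- to a preimage of `n`.
  · have hq (i) : ∃ w, map f LinearMap.id w = tmul T n (p i) :=
      (hfg _).1 (by rw [map_tmul, hn, zero_tmul])
    choose w hw using hq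
    refine ⟨∑ i, m.contract N₁ (q i) (w i), ?_⟩
    rw [map_sum, ← m.sum_contract_tmul h n]
    exact Finset.sum_congr rfl fun i _ => by rw [← m.contract_map, hw]
  · rintro ⟨n, rfl⟩
    refine left_inv (g ∘ₗ f) n fun i => ?_
    rw [← LinearMap.id_comp LinearMap.id, map_comp]
    exact hfg.apply_apply_eq_zero _

end MoritaContext

/-! ### Unit and counit of the adjunction, and their inverses in the strict case. -/

section UnitCounit

variable {A : Type*} {C : Type*} [Ring A] [AddCommGroup C] [Module A C] [Module Aᵐᵒᵖ C]
  [SMulCommClass A Aᵐᵒᵖ C] [Coring A C]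
  {X : Type*} [AddCommGroup X] [Module Aᵐᵒᵖ X] [RightComodule A C X]

variable (A C X) in
/-- The unit `N → Hom^C(X, N ⊗_T X)`, `n ↦ (x ↦ n ⊗ x)`. -/
def tensorUnit (N : Type*) [AddCommGroup N] [Module (comodEnd A C X)ᵐᵒᵖ N] :
    N →ₗ[(comodEnd A C X)ᵐᵒᵖ] comoduleHom A C X (BalTensor (comodEnd A C X) N X) where
  toFun n := ⟨tmulLin A C X n, fun _ => rfl⟩
  map_add' n n' := Subtype.ext (tmulLin_add n n')
  map_smul' t n := Subtype.ext (tmulLin_smul n t.unop)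

variable (A C X) in
/-- The counit `Hom^C(X, M) ⊗_T X → M`, `φ ⊗ x ↦ φ(x)`. -/
def tensorCounit (M : Type*) [AddCommGroup M] [Module Aᵐᵒᵖ M] [RightComodule A C M] :
    BalTensor (comodEnd A C X) (comoduleHom A C X M) X →ₗ[Aᵐᵒᵖ] M where
  __ := lift' (fun (φ : comoduleHom A C X M) (x : X) => φ.1 x) (fun _ _ _ => rfl)
    (fun φ _ _ => _root_.map_add φ.1 _ _) (fun _ _ _ => rfl)
  map_smul' := map_right_smul (lift' _ _ _ _) fun a φ x => _root_.map_smul φ.1 a x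

theorem tensorCounit_mem (M : Type*) [AddCommGroup M] [Module Aᵐᵒᵖ M] [RightComodule A C M] :
    tensorCounit A C X M ∈
      comoduleHom A C (BalTensor (comodEnd A C X) (comoduleHom A C X M) X) M := fun z =>
  hom_ext_apply (f := (coact A C : M →ₗ[Aᵐᵒᵖ] _).toAddMonoidHom.comp
      (tensorCounit A C X M).toAddMonoidHom)
    (g := (map (tensorCounit A C X M) LinearMap.id).comp
      (tensorCoact (A := A) (C := C) (X := X)).toAddMonoidHom)
    (fun φ x => by
      change coact A C (φ.1 x) = map (tensorCounit A C X M) LinearMap.id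
        (map (tmulLin A C X φ) LinearMap.id (coact A C x))
      rw [φ.2 x, ← map_comp]
      rfl) z

theorem tensorCounit_map_tensorUnit {N : Type*} [AddCommGroup N] [Module (comodEnd A C X)ᵐᵒᵖ N]
    (z : BalTensor (comodEnd A C X) N X) :
    tensorCounit A C X _ (map (tensorUnit A C X N) LinearMap.id z) = z :=
  hom_ext_apply (f := (tensorCounit A C X _).toAddMonoidHom.comp
    (map (tensorUnit A C X N) LinearMap.id)) (g := AddMonoidHom.id _) (fun _ _ => rfl) z

theorem comoduleAct_tmul {N : Type*} [AddCommGroup N] [Module (comodEnd A C X)ᵐᵒᵖ N]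
    (f : LeftDual A C) (n : N) (x : X) :
    comoduleAct (BalTensor (comodEnd A C X) N X) f (tmul (comodEnd A C X) n x) =
      tmul (comodEnd A C X) n (comoduleAct X f x) :=
  (map_comoduleAct (tmulLin A C X n) (tensorUnit A C X N n).2 f x).symm

/-- Both sides are `n ⊗ x · q(y)` on pure tensors, because `x · q(y)` is the value at `y` of the
endomorphism `xq ∈ T`, which moves across the tensor sign. This links the `*C`-action with
contraction. -/
theorem comoduleAct_eq_tmul_contract {N : Type*} [AddCommGroup N]
    [Module (comodEnd A C X)ᵐᵒᵖ N] (q : moritaQ A C X) (y : X)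
    (z : BalTensor (comodEnd A C X) N X) :
    comoduleAct (BalTensor (comodEnd A C X) N X) (q.1 y) z =
      tmul (comodEnd A C X) ((moritaContext A C X).contract N q z) y := by
  induction z using BalTensor.induction with
  | zero => rw [map_zero, map_zero, zero_tmul]
  | add z w hz hw => rw [map_add, map_add, add_tmul, hz, hw]
  | tmul n x => rw [comoduleAct_tmul, MoritaContext.contract_tmul, smul_tmul]; rfl

theorem comoduleAct_sum {M : Type*} [AddCommGroup M] [Module Aᵐᵒᵖ M] [RightComodule A C M]
    {ι : Type*} (s : Finset ι) (f : ι → LeftDual A C) (m : M) :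
    comoduleAct M (∑ i ∈ s, f i) m = ∑ i ∈ s, comoduleAct M (f i) m := by
  classical
  induction s using Finset.induction_on with
  | empty => exact comoduleAct_zero M m
  | insert i s hi ih => rw [Finset.sum_insert hi, Finset.sum_insert hi, comoduleAct_add, ih]

theorem sum_comoduleAct {k : ℕ} {x : Fin k → X} {q : Fin k → moritaQ A C X}
    (h : ∑ i, (moritaContext A C X).toT (tmul (LeftDual A C) (x i) (q i)) = 1) (y : X) :
    ∑ i, comoduleAct X ((q i).1 y) (x i) = y := by
  have := congrArg (fun t : comodEnd A C X => t • y) h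
  simp only [Finset.sum_smul, one_smul] at this
  exact this

theorem tensorUnit_bijective (h : (moritaContext A C X).IsStrict) (N : Type*) [AddCommGroup N]
    [Module (comodEnd A C X)ᵐᵒᵖ N] : Function.Bijective (tensorUnit A C X N) := by
  obtain ⟨k, x, q, hxq⟩ := (moritaContext A C X).exists_sum_toT_eq_one h.2.2
  refine Function.bijective_iff_has_inverse.2
    ⟨fun f => ∑ i, (moritaContext A C X).contract N (q i) (f.1 (x i)), fun n => ?_, fun f => ?_⟩
  · exact (moritaContext A C X).sum_contract_tmul hxq n
  · refine Subtype.ext (LinearMap.ext fun y => ?_)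
    change tmul _ _ y = f.1 y
    -- Since `y = ∑ xᵢ · qᵢ(y)` and `f` is `*C`-linear, `f(y) = ∑ f(xᵢ) · qᵢ(y)`, and each term is a
    -- contraction tensored with `y`.
    conv_rhs => rw [← sum_comoduleAct hxq y, map_sum]
    rw [BalTensor.sum_tmul]
    exact Finset.sum_congr rfl fun i _ => by
      rw [map_comoduleAct f.1 f.2, comoduleAct_eq_tmul_contract]

theorem tensorCounit_bijective (h : (moritaContext A C X).IsStrict) (M : Type*) [AddCommGroup M]
    [Module Aᵐᵒᵖ M] [RightComodule A C M] : Function.Bijective (tensorCounit A C X M) := by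
  obtain ⟨k, q, x, hqx⟩ := (moritaContext A C X).exists_sum_toS_eq_one h.1.2
  have hqx' : ∑ i, (q i).1 (x i) = 1 := hqx
  refine Function.bijective_iff_has_inverse.2
    -- The inverse sends `m` to `∑ (y ↦ m · qᵢ(y)) ⊗ xᵢ`; evaluating gives `m · ∑ qᵢ(xᵢ) = m`.
    ⟨fun m => ∑ i, tmul (comodEnd A C X)
      (⟨actLin (q i).1 (coact A C m), actLin_mem (q i) m⟩ : comoduleHom A C X M) (x i),
      fun z => ?_, fun m => ?_⟩
  · conv_rhs => rw [← (moritaContext A C X).sum_tmul_contract hqx z]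
    refine Finset.sum_congr rfl fun i _ => congrArg (fun φ => tmul _ φ (x i)) ?_
    refine Subtype.ext (LinearMap.ext fun y => ?_)
    change comoduleAct M ((q i).1 y) (tensorCounit A C X M z) = _
    rw [← map_comoduleAct _ (tensorCounit_mem M), comoduleAct_eq_tmul_contract]
    rfl
  · rw [map_sum]
    change ∑ i, comoduleAct M ((q i).1 (x i)) m = m
    rw [← comoduleAct_sum, hqx', comoduleAct_one]

end UnitCounit

/-! ### The adjunction and the reformulation of condition 3. -/

section Adjunction

open CategoryTheory

variable (A C : Type u) [Ring A] [AddCommGroup C] [Module A C] [Module Aᵐᵒᵖ C]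
  [SMulCommClass A Aᵐᵒᵖ C] [Coring A C]
  (X : Type u) [AddCommGroup X] [Module Aᵐᵒᵖ X] [RightComodule A C X]

/-- The functor `- ⊗_T X` is left adjoint to `Hom^C(X, -)`. -/
def tensorHomAdjunction : tensorFunctor A C X ⊣ homFunctor A C X :=
  Adjunction.mkOfUnitCounit
    { unit := { app := fun N => ModuleCat.ofHom (tensorUnit A C X N)
                naturality := fun _ _ _ => rfl }
      counit :=
        { app := fun M => ⟨tensorCounit A C X M.carrier, tensorCounit_mem M.carrier⟩
          naturality := fun M M' f => Subtype.ext (LinearMap.ext fun z =>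
            hom_ext_apply
              (f := (tensorCounit A C X M'.carrier).toAddMonoidHom.comp
                (map ((homFunctor A C X).map f).hom LinearMap.id))
              (g := f.1.toAddMonoidHom.comp (tensorCounit A C X M.carrier).toAddMonoidHom)
              (fun _ _ => rfl) z) }
      left_triangle := by
        ext N
        exact Subtype.ext (LinearMap.ext fun z => tensorCounit_map_tensorUnit z)
      right_triangle := rfl }

variable {A C} in
theorem ComodCat.isIso_iff_bijective {M N : ComodCat A C} (f : M ⟶ N) :
    IsIso f ↔ Function.Bijective f.1 := by
  refine ⟨fun _ => ?_, fun hf => ?_⟩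
  · refine Function.bijective_iff_has_inverse.2 ⟨(inv f).1, fun m => ?_, fun n => ?_⟩
    · exact congrArg (fun g : M ⟶ M => g.1 m) (IsIso.hom_inv_id f)
    · exact congrArg (fun g : N ⟶ N => g.1 n) (IsIso.inv_hom_id f)
  · let e := LinearEquiv.ofBijective f.1 hf
    refine ⟨⟨e.symm.toLinearMap, fun n => ?_⟩, Subtype.ext (LinearMap.ext e.symm_apply_apply),
      Subtype.ext (LinearMap.ext e.apply_symm_apply)⟩
    -- Colinearity of the inverse is checked on elements of the form `f m`.
    obtain ⟨m, rfl⟩ := e.surjective n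
    change coact A C (e.symm (e m)) = map e.symm.toLinearMap LinearMap.id (coact A C (f.1 m))
    rw [e.symm_apply_apply, f.2 m, ← map_comp]
    have : e.symm.toLinearMap ∘ₗ f.1 = LinearMap.id := LinearMap.ext e.symm_apply_apply
    rw [this]
    exact (map_id _).symm

/-- The unit of a given equivalence need not be `tensorUnit`, but once both functors are
equivalences, the unit and counit of any adjunction between them are isomorphisms. -/
theorem exists_equivalence_iff :
    (∃ e : ModuleCat.{u} (comodEnd A C X)ᵐᵒᵖ ≌ ComodCat A C,
      e.functor = tensorFunctor A C X ∧ e.inverse = homFunctor A C X) ↔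
    (∀ (N : Type u) [AddCommGroup N] [Module (comodEnd A C X)ᵐᵒᵖ N],
      Function.Bijective (tensorUnit A C X N)) ∧
    (∀ (M : Type u) [AddCommGroup M] [Module Aᵐᵒᵖ M] [RightComodule A C M],
      Function.Bijective (tensorCounit A C X M)) := by
  constructor
  · rintro ⟨e, he, he'⟩
    have : (tensorFunctor A C X).IsEquivalence := he ▸ inferInstance
    have : (homFunctor A C X).IsEquivalence := he' ▸ inferInstance
    refine ⟨fun N _ _ => ?_, fun M _ _ _ => ?_⟩
    · exact (ConcreteCategory.isIso_iff_bijective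
        ((tensorHomAdjunction A C X).unit.app (ModuleCat.of _ N))).1 inferInstance
    · exact (ComodCat.isIso_iff_bijective
        ((tensorHomAdjunction A C X).counit.app ⟨M⟩)).1 inferInstance
  · rintro ⟨hN, hM⟩
    have h₁ (N) : IsIso ((tensorHomAdjunction A C X).unit.app N) :=
      (ConcreteCategory.isIso_iff_bijective _).2 (hN N)
    have h₂ (M) : IsIso ((tensorHomAdjunction A C X).counit.app M) :=
      (ComodCat.isIso_iff_bijective _).2 (hM M.carrier)
    exact ⟨(tensorHomAdjunction A C X).toEquivalence, rfl, rfl⟩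

end Adjunction

/-! ### Cofree comodules `N ⊗_A C`. -/

section Cofree

variable {A : Type*} {C : Type*} [Ring A] [AddCommGroup C] [Module A C] [Module Aᵐᵒᵖ C]
  [SMulCommClass A Aᵐᵒᵖ C]

theorem BalTensor.map_sub_left {R M N M' N' : Type*} [Ring R]
    [AddCommGroup M] [Module Rᵐᵒᵖ M] [AddCommGroup N] [Module R N]
    [AddCommGroup M'] [Module Rᵐᵒᵖ M'] [AddCommGroup N'] [Module R N']
    (f f' : M →ₗ[Rᵐᵒᵖ] M') (g : N →ₗ[R] N') (z : BalTensor R M N) :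
    map (f - f') g z = map f g z - map f' g z :=
  eq_sub_of_add_eq (by rw [← map_add_left, sub_add_cancel])

theorem BalTensor.assoc_map_rTensor {M N : Type*} [AddCommGroup M] [Module Aᵐᵒᵖ M]
    [AddCommGroup N] [Module Aᵐᵒᵖ N] (f : M →ₗ[Aᵐᵒᵖ] N)
    (z : BalTensor A (BalTensor A M C) C) :
    assoc (map (rTensor (S := A) C f) (LinearMap.id : C →ₗ[A] C) z) =
      map f LinearMap.id (assoc z) := by
  refine hom_ext_apply (f := assoc.toAddMonoidHom.comp
      (map (rTensor (S := A) C f) (LinearMap.id : C →ₗ[A] C)))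
    (g := (map f LinearMap.id).comp assoc.toAddMonoidHom) (fun w c => ?_) z
  induction w using BalTensor.induction with
  | zero => rw [zero_tmul, _root_.map_zero, _root_.map_zero]
  | tmul y d => rfl
  | add u v hu hv => rw [add_tmul, _root_.map_add, _root_.map_add, hu, hv]

variable {M : Type*} [AddCommGroup M] [Module Aᵐᵒᵖ M]
  {N : Type*} [AddCommGroup N] [Module Aᵐᵒᵖ N]

variable (C) in
/-- For `n ∈ N`, the right `A`-linear map `C → N ⊗_A C`, `c ↦ n ⊗ c`. -/
def tmulRight (n : N) : C →ₗ[Aᵐᵒᵖ] BalTensor A N C where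
  toFun c := tmul A n c
  map_add' := tmul_add n
  map_smul' _ _ := rfl

theorem assocInv_tmul_eq (n : N) (w : BalTensor A C C) :
    assocInv (tmul A n w) = map (tmulRight C n) LinearMap.id w :=
  hom_ext_apply (f := AddMonoidHom.mk' (fun w => assocInv (tmul A n w))
      fun _ _ => by rw [tmul_add, map_add])
    (g := map (tmulRight C n) LinearMap.id) (fun _ _ => rfl) w

variable [Coring A C]

variable (A C) in
/-- The map `N ⊗_A C → N`, `n ⊗ c ↦ n · ε(c)`. -/
def counitMap (N : Type*) [AddCommGroup N] [Module Aᵐᵒᵖ N] : BalTensor A N C →ₗ[Aᵐᵒᵖ] N where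
  __ := actMap (Coring.counit : C →ₗ[A] A) N
  map_smul' := map_right_smul (actMap _ N) fun a n c => by
    rw [actMap_tmul, actMap_tmul, Coring.counit_op_smul, ← op_unop a, op_smul_eq_mul, op_mul,
      mul_smul]

variable (A C) in
/-- The coaction `n ⊗ c ↦ (n ⊗ c⁽¹⁾) ⊗ c⁽²⁾` on `N ⊗_A C`. -/
def cofreeCoact (N : Type*) [AddCommGroup N] [Module Aᵐᵒᵖ N] :
    BalTensor A N C →ₗ[Aᵐᵒᵖ] BalTensor A (BalTensor A N C) C where
  __ := assocInv.comp (map LinearMap.id (Coring.comulL A C))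
  map_smul' := map_right_smul (assocInv.comp (map LinearMap.id (Coring.comulL A C)))
    fun a n c => by
      change assocInv (tmul A n (Coring.comul (a • c))) = a • assocInv (tmul A n (Coring.comul c))
      rw [Coring.comul_op_smul, assocInv_tmul_eq, assocInv_tmul_eq]
      exact (rTensor (S := A) C (tmulRight C n)).map_smul a _

theorem cofreeCoact_apply (z : BalTensor A N C) :
    cofreeCoact A C N z = assoc.symm (map LinearMap.id (Coring.comulL A C) z) :=
  rfl

theorem cofreeCoact_tmul (n : N) (c : C) :
    cofreeCoact A C N (tmul A n c) = map (tmulRight C n) LinearMap.id (Coring.comulR A C c) :=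
  assocInv_tmul_eq n _

/-- The cofree right comodule `N ⊗_A C`. -/
instance cofreeComodule : RightComodule A C (BalTensor A N C) where
  coact := cofreeCoact A C N
  coassoc z := by
    refine hom_ext_apply (f := (assoc.toAddMonoidHom.comp
        (map (cofreeCoact A C N) LinearMap.id)).comp (cofreeCoact A C N).toAddMonoidHom)
      (g := (map LinearMap.id (Coring.comulL A C)).comp (cofreeCoact A C N).toAddMonoidHom)
      (fun n c => ?_) z
    change assoc (map (cofreeCoact A C N) LinearMap.id (cofreeCoact A C N (tmul A n c))) =
      map LinearMap.id (Coring.comulL A C) (cofreeCoact A C N (tmul A n c))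
    rw [cofreeCoact_tmul, ← map_comp]
    have h : cofreeCoact A C N ∘ₗ tmulRight C n =
        rTensor (S := A) C (tmulRight C n) ∘ₗ Coring.comulR A C :=
      LinearMap.ext fun c => cofreeCoact_tmul n c
    rw [h, map_comp, assoc_map_rTensor]
    refine (congrArg _ (Coring.coassoc c)).trans ?_
    rw [← map_comp, ← map_comp]
    rfl
  counit z := by
    refine hom_ext_apply (f := (actMap (Coring.counit : C →ₗ[A] A) _).comp
      (cofreeCoact A C N).toAddMonoidHom) (g := AddMonoidHom.id _) (fun n c => ?_) z
    change actMap (Coring.counit : C →ₗ[A] A) _ (cofreeCoact A C N (tmul A n c)) = tmul A n c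
    rw [cofreeCoact_tmul]
    refine Eq.trans ?_ (congrArg (tmul A n) (Coring.counit_right (A := A) c))
    exact hom_ext_apply (f := (actMap (Coring.counit : C →ₗ[A] A) _).comp
        (map (tmulRight C n) LinearMap.id))
      (g := (tmulRight C n).toAddMonoidHom.comp (actMap (Coring.counit : C →ₗ[A] A) C))
      (fun _ _ => rfl) _

/-- The left counit law of `C`, tensored with `N`. -/
theorem map_counitMap_cofreeCoact (z : BalTensor A N C) :
    map (counitMap A C N) LinearMap.id (cofreeCoact A C N z) = z := by
  refine hom_ext_apply (f := (map (counitMap A C N) LinearMap.id).comp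
    (cofreeCoact A C N).toAddMonoidHom) (g := AddMonoidHom.id _) (fun n c => ?_) z
  change map (counitMap A C N) LinearMap.id (cofreeCoact A C N (tmul A n c)) = tmul A n c
  rw [cofreeCoact_tmul, ← map_comp]
  conv_rhs => rw [← Coring.counit_left (A := A) c]
  exact hom_ext_apply (f := map (counitMap A C N ∘ₗ tmulRight C n) LinearMap.id)
    (g := AddMonoidHom.comp (tmulRight C n).toAddMonoidHom
      (lift' (fun (d e : C) => Coring.counit (A := A) d • e) _ _ _))
    (fun d e => smul_tmul n (Coring.counit d) e) _

theorem map_coact_coact [RightComodule A C M] (m : M) :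
    map (coact A C) LinearMap.id (coact A C m) = cofreeCoact A C M (coact A C m) := by
  rw [cofreeCoact_apply, ← RightComodule.coassoc, AddEquiv.symm_apply_apply]

variable {X : Type*} [AddCommGroup X] [Module Aᵐᵒᵖ X] [RightComodule A C X]

/-- By coassociativity of `X`, the map `(φ ⊗ C)ρ` is colinear into the cofree comodule. -/
theorem cofreeCoact_map_coact (φ : X →ₗ[Aᵐᵒᵖ] N) (x : X) :
    cofreeCoact A C N (map φ LinearMap.id (coact A C x)) =
      map (rTensor C φ ∘ₗ coact A C) LinearMap.id (coact A C x) := by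
  rw [← LinearMap.id_comp (LinearMap.id : C →ₗ[A] C), map_comp (rTensor C φ), LinearMap.id_comp,
    cofreeCoact_apply, AddEquiv.symm_apply_eq, assoc_map_rTensor, RightComodule.coassoc,
    ← map_comp, ← map_comp]
  rfl

end Cofree

/-! ### The canonical map as a counit, and `Hom^C(X, M)` as a kernel. -/

section CanonicalMap

variable {A : Type*} {C : Type*} [Ring A] [AddCommGroup C] [Module A C] [Module Aᵐᵒᵖ C]
  [SMulCommClass A Aᵐᵒᵖ C] [Coring A C]
  {X : Type*} [AddCommGroup X] [Module Aᵐᵒᵖ X] [RightComodule A C X]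
  {M : Type*} [AddCommGroup M] [Module Aᵐᵒᵖ M]
  {N : Type*} [AddCommGroup N] [Module Aᵐᵒᵖ N]

variable (A C X N) in
/-- The right `T`-linear map `Hom_A(X, N) → Hom^C(X, N ⊗_A C)`, `φ ↦ (x ↦ φ(x⁽⁰⁾) ⊗ x⁽¹⁾)`. -/
def cofreeHom : (X →ₗ[Aᵐᵒᵖ] N) →ₗ[(comodEnd A C X)ᵐᵒᵖ] comoduleHom A C X (BalTensor A N C) where
  toFun φ := ⟨rTensor C φ ∘ₗ coact A C, cofreeCoact_map_coact φ⟩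
  map_add' φ ψ := Subtype.ext (LinearMap.ext fun _ => map_add_left φ ψ _ _)
  map_smul' t φ := Subtype.ext (LinearMap.ext fun x => by
    change map (φ ∘ₗ t.unop.1) LinearMap.id (coact A C x) =
      map φ LinearMap.id (coact A C (t.unop.1 x))
    rw [t.unop.2 x, ← map_comp]
    rfl)

/-- The cofree comodule is right adjoint to forgetting the coaction; the inverse composes with `N ⊗
ε`. -/
theorem cofreeHom_bijective : Function.Bijective (cofreeHom A C X N) := by
  refine Function.bijective_iff_has_inverse.2
    ⟨fun ψ => counitMap A C N ∘ₗ ψ.1, fun φ => ?_, fun ψ => ?_⟩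
  · refine LinearMap.ext fun x => ?_
    refine Eq.trans ?_ (congrArg φ (RightComodule.counit (A := A) (C := C) x))
    exact hom_ext_apply (f := (counitMap A C N).toAddMonoidHom.comp (map φ LinearMap.id))
      (g := φ.toAddMonoidHom.comp (actMap (Coring.counit : C →ₗ[A] A) X))
      (fun x c => (_root_.map_smul φ _ x).symm) _
  · refine Subtype.ext (LinearMap.ext fun x => ?_)
    change map (counitMap A C N ∘ₗ ψ.1) LinearMap.id (coact A C x) = ψ.1 x
    rw [← LinearMap.id_comp (LinearMap.id : C →ₗ[A] C), map_comp, ← ψ.2 x]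
    exact map_counitMap_cofreeCoact _

theorem tensorCounit_map_cofreeHom (z : BalTensor (comodEnd A C X) (X →ₗ[Aᵐᵒᵖ] N) X) :
    tensorCounit A C X _ (map (cofreeHom A C X N) LinearMap.id z) = can A C X N z :=
  hom_ext_apply (f := (tensorCounit A C X _).toAddMonoidHom.comp
    (map (cofreeHom A C X N) LinearMap.id)) (g := can A C X N) (fun _ _ => rfl) z

theorem BalTensor.map_bijective {R M M' N : Type*} [Ring R] [AddCommGroup M] [Module Rᵐᵒᵖ M]
    [AddCommGroup M'] [Module Rᵐᵒᵖ M'] [AddCommGroup N] [Module R N] {f : M →ₗ[Rᵐᵒᵖ] M'}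
    (hf : Function.Bijective f) :
    Function.Bijective (map f (LinearMap.id : N →ₗ[R] N)) := by
  let e := LinearEquiv.ofBijective f hf
  refine Function.bijective_iff_has_inverse.2
    ⟨map e.symm.toLinearMap LinearMap.id, fun z => ?_, fun z => ?_⟩
  · rw [← map_comp]
    have : e.symm.toLinearMap ∘ₗ f = LinearMap.id := LinearMap.ext e.symm_apply_apply
    rw [this]
    exact map_id z
  · rw [← map_comp]
    have : f ∘ₗ e.symm.toLinearMap = LinearMap.id := LinearMap.ext e.apply_symm_apply
    rw [this]
    exact map_id z

theorem can_bijective (h : Function.Bijective (tensorCounit A C X (BalTensor A N C))) :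
    Function.Bijective (can A C X N) := by
  have := h.comp (map_bijective (N := X) (cofreeHom_bijective (A := A) (C := C) (X := X) (N := N)))
  convert this using 1
  exact funext fun z => (tensorCounit_map_cofreeHom z).symm

variable (A C X M) in
/-- The inclusion `Hom^C(X, M) → Hom_A(X, M)`. -/
def comoduleHomIncl [RightComodule A C M] :
    comoduleHom A C X M →ₗ[(comodEnd A C X)ᵐᵒᵖ] (X →ₗ[Aᵐᵒᵖ] M) where
  __ := (comoduleHom A C X M).subtype
  map_smul' _ _ := rfl

variable (A C X M) in
/-- The map `Hom_A(X, M) → Hom_A(X, M ⊗_A C)` whose kernel is `Hom^C(X, M)`. -/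
def comoduleHomDefect [RightComodule A C M] :
    (X →ₗ[Aᵐᵒᵖ] M) →ₗ[(comodEnd A C X)ᵐᵒᵖ] (X →ₗ[Aᵐᵒᵖ] BalTensor A M C) where
  toFun φ := coact A C ∘ₗ φ - (cofreeHom A C X M φ).1
  map_add' φ ψ := by
    rw [map_add, LinearMap.comp_add, AddSubgroup.coe_add]
    abel
  map_smul' t φ := by
    rw [_root_.map_smul]
    rfl

theorem exact_comoduleHomIncl_defect [RightComodule A C M] :
    Function.Exact (comoduleHomIncl A C X M) (comoduleHomDefect A C X M) := fun φ =>
  ⟨fun h => ⟨⟨φ, fun x => sub_eq_zero.1 (LinearMap.congr_fun h x)⟩, rfl⟩, by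
    rintro ⟨φ, rfl⟩
    exact LinearMap.ext fun x => sub_eq_zero.2 (φ.2 x)⟩

/-- With `can_map_defect`, this gives the commuting squares that compare the defining sequence of
`Hom^C(X, M)`, tensored with `X`, with `M → M ⊗_A C → M ⊗_A C ⊗_A C`. -/
theorem coact_tensorCounit [RightComodule A C M]
    (z : BalTensor (comodEnd A C X) (comoduleHom A C X M) X) :
    coact A C (tensorCounit A C X M z) =
      can A C X M (map (comoduleHomIncl A C X M) LinearMap.id z) :=
  hom_ext_apply (f := (coact A C : M →ₗ[Aᵐᵒᵖ] _).toAddMonoidHom.comp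
      (tensorCounit A C X M).toAddMonoidHom)
    (g := (can A C X M).comp (map (comoduleHomIncl A C X M) LinearMap.id))
    (fun φ x => φ.2 x) z

theorem can_map_defect [RightComodule A C M]
    (z : BalTensor (comodEnd A C X) (X →ₗ[Aᵐᵒᵖ] M) X) :
    can A C X _ (map (comoduleHomDefect A C X M) LinearMap.id z) =
      map (coact A C) LinearMap.id (can A C X M z) - cofreeCoact A C M (can A C X M z) :=
  hom_ext_apply (f := (can A C X _).comp (map (comoduleHomDefect A C X M) LinearMap.id))
    (g := (map (coact A C) LinearMap.id).comp (can A C X M) -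
      (cofreeCoact A C M).toAddMonoidHom.comp (can A C X M))
    (fun φ x => by
      change map (coact A C ∘ₗ φ - (rTensor C φ ∘ₗ coact A C)) LinearMap.id (coact A C x) =
        map (coact A C) LinearMap.id (map φ LinearMap.id (coact A C x)) -
          cofreeCoact A C M (map φ LinearMap.id (coact A C x))
      rw [map_sub_left, cofreeCoact_map_coact, ← map_comp]
      rfl) z

theorem coact_injective [RightComodule A C M] :
    Function.Injective (coact A C : M →ₗ[Aᵐᵒᵖ] BalTensor A M C) :=
  Function.LeftInverse.injective (RightComodule.counit (A := A) (C := C))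

end CanonicalMap

/-! ### Galois and faithfully flat comodules: condition 2 implies condition 3. -/

section FaithfullyFlat

variable {R P : Type u} [Ring R] [AddCommGroup P] [Module R P]

theorem IsFaithfullyFlat.injective_iff (h : IsFaithfullyFlat R P) {N N' : Type u}
    [AddCommGroup N] [Module Rᵐᵒᵖ N] [AddCommGroup N'] [Module Rᵐᵒᵖ N'] (f : N →ₗ[Rᵐᵒᵖ] N') :
    Function.Injective (BalTensor.map f (LinearMap.id : P →ₗ[R] P)) ↔ Function.Injective f := by
  -- Injectivity is exactness of `0 → N → N'`.
  have h₀ := h PUnit.{u + 1} N N' 0 f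
  rw [injective_iff_map_eq_zero, injective_iff_map_eq_zero]
  simp only [Function.Exact, Set.mem_range, LinearMap.zero_apply, exists_const,
    BalTensor.map_zero_left, eq_comm (a := (0 : N)),
    eq_comm (a := (0 : BalTensor R N P))] at h₀
  constructor
  · exact fun hf n => (h₀.2 (fun z => ⟨hf z, fun hz => by rw [hz, map_zero]⟩) n).1
  · exact fun hf z => (h₀.1 (fun n => ⟨hf n, fun hn => by rw [hn, map_zero]⟩) z).1

theorem IsFaithfullyFlat.surjective_of_map (h : IsFaithfullyFlat R P) {N N' : Type u}
    [AddCommGroup N] [Module Rᵐᵒᵖ N] [AddCommGroup N'] [Module Rᵐᵒᵖ N'] (f : N →ₗ[Rᵐᵒᵖ] N')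
    (hf : Function.Surjective (BalTensor.map f (LinearMap.id : P →ₗ[R] P))) :
    Function.Surjective f := fun n =>
  ((h N N' PUnit.{u + 1} f 0).2 (fun z => ⟨fun _ => hf z, fun _ => BalTensor.map_zero_left _ z⟩)
    n).1 rfl

variable {A : Type u} {C : Type u} [Ring A] [AddCommGroup C] [Module A C] [Module Aᵐᵒᵖ C]
  [SMulCommClass A Aᵐᵒᵖ C] [Coring A C]
  {X : Type u} [AddCommGroup X] [Module Aᵐᵒᵖ X] [RightComodule A C X]

theorem IsGaloisComodule.tensorCounit_bijective (hX : IsGaloisComodule A C X)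
    (hF : IsFaithfullyFlat (comodEnd A C X) X) (M : Type u) [AddCommGroup M] [Module Aᵐᵒᵖ M]
    [RightComodule A C M] : Function.Bijective (tensorCounit A C X M) := by
  constructor
  · refine Function.Injective.of_comp (f := coact A C) ?_
    have hι : Function.Injective (comoduleHomIncl A C X M) := Subtype.val_injective
    have := (hX M).1.comp ((hF.injective_iff _).2 hι)
    convert this using 1
    exact funext coact_tensorCounit
  · intro m
    -- The preimage of `ρ(m)` under the canonical map is killed by the defect because `(ρ ⊗ C)ρ(m) =
    -- (M ⊗ Δ)ρ(m)`, so flatness moves it into `Hom^C(X, M) ⊗_T X`.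
    obtain ⟨z, hz⟩ := (hX M).2 (coact A C m)
    have h₀ : BalTensor.map (comoduleHomDefect A C X M) LinearMap.id z = 0 := by
      refine (hX _).1 ?_
      rw [can_map_defect, hz, map_coact_coact, sub_self, map_zero]
    obtain ⟨w, rfl⟩ := ((hF _ _ _ _ _).1 exact_comoduleHomIncl_defect z).1 h₀
    exact ⟨w, coact_injective (C := C) ((coact_tensorCounit w).trans hz)⟩

/-- After `- ⊗_T X` the unit is a section of the counit at `N ⊗_T X`; as that counit is injective,
the section is bijective, and faithful flatness reflects this. -/
theorem IsFaithfullyFlat.tensorUnit_bijective (hF : IsFaithfullyFlat (comodEnd A C X) X)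
    (N : Type u) [AddCommGroup N] [Module (comodEnd A C X)ᵐᵒᵖ N]
    (h : Function.Injective (tensorCounit A C X (BalTensor (comodEnd A C X) N X))) :
    Function.Bijective (tensorUnit A C X N) := by
  refine ⟨(hF.injective_iff _).1 ?_, hF.surjective_of_map _ fun z =>
    ⟨tensorCounit A C X _ z, h (tensorCounit_map_tensorUnit _)⟩⟩
  exact Function.LeftInverse.injective (g := tensorCounit A C X _) tensorCounit_map_tensorUnit

end FaithfullyFlat

/-! ### Dual bases and the comodule structure of `*C`. -/

section Dual

theorem exists_dual_basis (A C : Type*) [Ring A] [AddCommGroup C] [Module A C]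
    [Module.Finite A C] [Module.Projective A C] :
    ∃ (n : ℕ) (b : Fin n → C) (φ : Fin n → LeftDual A C), ∀ c, ∑ i, φ i c • b i = c := by
  obtain ⟨n, f, g, -, -, hfg⟩ := Module.Finite.exists_comp_eq_id_of_projective A C
  refine ⟨n, fun i => f (Pi.single i 1), fun i => LinearMap.proj i ∘ₗ g, fun c => ?_⟩
  conv_rhs => rw [← LinearMap.id_apply (R := A) c, ← hfg, LinearMap.comp_apply,
    LinearMap.pi_apply_eq_sum_univ f (g c)]
  refine Finset.sum_congr rfl fun i _ => congrArg (fun e => g c i • f e) (funext fun j => ?_)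
  simp [Pi.single_apply, eq_comm]

variable {A : Type*} {C : Type*} [Ring A] [AddCommGroup C] [Module A C]

/-- The evaluation `*C ⊗_A N → N`, `f ⊗ n ↦ f(c) n`, at an element `c ∈ C`. -/
def dualEval {N : Type*} [AddCommGroup N] [Module A N] (c : C) :
    BalTensor A (LeftDual A C) N →+ N :=
  lift' (fun f n => f c • n) (fun _ _ _ => add_smul _ _ _) (fun _ _ _ => smul_add _ _ _)
    (fun _ _ _ => mul_smul _ _ _)

theorem dualEval_map {N N' : Type*} [AddCommGroup N] [Module A N] [AddCommGroup N'] [Module A N']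
    (g : N →ₗ[A] N') (c : C) (z : BalTensor A (LeftDual A C) N) :
    dualEval c (map LinearMap.id g z) = g (dualEval c z) :=
  hom_ext_apply (f := (dualEval c).comp (map LinearMap.id g))
    (g := g.toAddMonoidHom.comp (dualEval c)) (fun f _ => (_root_.map_smul g (f c) _).symm) z

variable {n : ℕ} {b : Fin n → C} {φ : Fin n → LeftDual A C}

theorem sum_op_smul_dual (h : ∀ c, ∑ i, φ i c • b i = c) (f : LeftDual A C) :
    ∑ i, op (f (b i)) • φ i = f := by
  refine LinearMap.ext fun c => ?_
  conv_rhs => rw [← h c]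
  refine (LinearMap.sum_apply _ _ c).trans ?_
  refine Eq.trans ?_ (map_sum f.toLin _ _).symm
  exact Finset.sum_congr rfl fun i _ => (LeftDual.map_smul f _ _).symm

theorem sum_tmul_dualEval (h : ∀ c, ∑ i, φ i c • b i = c) {N : Type*} [AddCommGroup N]
    [Module A N] (z : BalTensor A (LeftDual A C) N) :
    ∑ i, tmul A (φ i) (dualEval (b i) z) = z := by
  induction z using BalTensor.induction with
  | zero => simp [tmul_zero]
  | add x y hx hy => simp only [_root_.map_add, tmul_add, Finset.sum_add_distrib, hx, hy]
  | tmul f m =>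
    conv_rhs => rw [← sum_op_smul_dual h f, BalTensor.sum_tmul]
    exact Finset.sum_congr rfl fun i _ => (smul_tmul _ _ _).symm

/-- Injectivity of `*C ⊗_A N → Hom_A(C, N)`, which reduces identities for the coaction on `*C` to
identities evaluated at elements of `C`. -/
theorem dualEval_ext (h : ∀ c, ∑ i, φ i c • b i = c) {N : Type*} [AddCommGroup N]
    [Module A N] {z w : BalTensor A (LeftDual A C) N} (hzw : ∀ c, dualEval c z = dualEval c w) :
    z = w := by
  rw [← sum_tmul_dualEval h z, ← sum_tmul_dualEval h w]
  simp only [hzw]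

variable [Module Aᵐᵒᵖ C] [SMulCommClass A Aᵐᵒᵖ C]

/-- Evaluation `*C ⊗_A C → C` at `c ∈ C`, as a right `A`-linear map. -/
def dualEvalRight (c : C) : BalTensor A (LeftDual A C) C →ₗ[Aᵐᵒᵖ] C where
  __ := dualEval c
  map_smul' := map_right_smul (dualEval c) fun a f d => smul_comm (f c) a d

theorem dualEval_assoc (c : C) (z : BalTensor A (BalTensor A (LeftDual A C) C) C) :
    dualEval c (assoc z) = map (dualEvalRight c) LinearMap.id z := by
  refine hom_ext_apply (f := (dualEval c).comp assoc.toAddMonoidHom)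
    (g := map (dualEvalRight c) LinearMap.id) (fun w e => ?_) z
  induction w using BalTensor.induction with
  | zero => rw [zero_tmul, _root_.map_zero, _root_.map_zero]
  | tmul y d => rfl
  | add u v hu hv => rw [add_tmul, _root_.map_add, _root_.map_add, hu, hv]

variable [Coring A C]

variable (b φ) in
/-- The coaction `f ↦ ∑ φᵢ ⊗ bᵢ⁽¹⁾ f(bᵢ⁽²⁾)` on `*C`, for a dual basis `bᵢ`, `φᵢ`. -/
def dualCoact : LeftDual A C →ₗ[Aᵐᵒᵖ] BalTensor A (LeftDual A C) C where
  toFun f := ∑ i, tmul A (φ i) (comoduleAct C f (b i))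
  map_add' f g := by simp only [comoduleAct_add, tmul_add, Finset.sum_add_distrib]
  map_smul' a f := by
    simp only [comoduleAct_op_smul, Finset.smul_sum, right_smul_tmul, RingHom.id_apply]

/-- The characterization `f⁽⁰⁾(c) f⁽¹⁾ = c⁽¹⁾ f(c⁽²⁾)` of the coaction, which has the shape of the
condition defining `Q`. -/
theorem dualEval_dualCoact (h : ∀ c, ∑ i, φ i c • b i = c) (f : LeftDual A C) (c : C) :
    dualEval c (dualCoact b φ f) = comoduleAct C f c := by
  conv_rhs => rw [← h c, map_sum]
  change dualEval c (∑ i, tmul A (φ i) (comoduleAct C f (b i))) = _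
  rw [map_sum]
  refine Finset.sum_congr rfl fun i _ => ?_
  exact (comoduleAct_smul f _ _).symm

theorem sum_comoduleAct_tmul (h : ∀ c, ∑ i, φ i c • b i = c) (f : LeftDual A C) (c : C) :
    ∑ i, tmul A (comoduleAct C (φ i) c) (comoduleAct C f (b i)) =
      map LinearMap.id (comoduleActL f) (Coring.comul c) := by
  change ∑ i, tmul A (actMap (φ i).toLin C (Coring.comul c)) _ = _
  induction (Coring.comul c : BalTensor A C C) using BalTensor.induction with
  | zero => simp [zero_tmul]
  | add x y hx hy => simp only [_root_.map_add, add_tmul, Finset.sum_add_distrib, hx, hy]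
  | tmul d e =>
    simp only [actMap_tmul, smul_tmul, ← comoduleAct_smul, map_tmul]
    rw [← BalTensor.tmul_sum, ← map_sum]
    exact congrArg (fun e => tmul A d (comoduleAct C f e)) (h e)

/-- The left dual of a finitely generated projective coring, as a right comodule. -/
abbrev dualComodule (h : ∀ c, ∑ i, φ i c • b i = c) : RightComodule A C (LeftDual A C) where
  coact := dualCoact b φ
  coassoc f := by
    -- Evaluated at `c`, one side is `Δ(c⁽¹⁾ f(c⁽²⁾)) = c⁽¹⁾ ⊗ c⁽²⁾ f(c⁽³⁾)`; the other is its dual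
    -- basis expansion, `sum_comoduleAct_tmul`.
    refine dualEval_ext h fun c => ?_
    rw [dualEval_assoc, dualEval_map, dualEval_dualCoact h, ← map_comp]
    refine Eq.trans ?_ (coact_comoduleAct C f c).symm
    rw [LinearMap.id_comp]
    refine Eq.trans ?_ (sum_comoduleAct_tmul h f c)
    change map (dualEvalRight c ∘ₗ dualCoact b φ) LinearMap.id
      (∑ i, tmul A (φ i) (comoduleAct C f (b i))) = _
    rw [map_sum]
    refine Finset.sum_congr rfl fun i _ => ?_
    exact congrArg (fun d => tmul A d _) (dualEval_dualCoact h (φ i) c)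
  counit f := by
    change actMap _ _ (∑ i, tmul A (φ i) (comoduleAct C f (b i))) = f
    rw [map_sum]
    conv_rhs => rw [← sum_op_smul_dual h f]
    -- `ε(bᵢ⁽¹⁾ f(bᵢ⁽²⁾))` is the value at `bᵢ` of the product `f * 1` in `*C`.
    exact Finset.sum_congr rfl fun i _ =>
      congrArg (fun a => op a • φ i) (congrArg (fun g : LeftDual A C => g (b i)) (mul_one f))

variable {X : Type*} [AddCommGroup X] [Module Aᵐᵒᵖ X] [RightComodule A C X]

theorem mem_moritaQ_of_mem_comoduleHom (h : ∀ c, ∑ i, φ i c • b i = c)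
    (q : X →ₗ[Aᵐᵒᵖ] LeftDual A C)
    (hq : ∀ x, dualCoact b φ (q x) = map q LinearMap.id (coact A C x)) : q ∈ moritaQ A C X := by
  intro x c
  rw [← dualEval_dualCoact h, hq x]
  exact hom_ext_apply (f := qMap q c) (g := (dualEval c).comp (map q LinearMap.id))
    (fun _ _ => rfl) _

/-- Comodule maps `X → *C` lie in `Q`, so values of the counit at `*C` are values of `toS`. -/
theorem toS_surjective (h : ∀ c, ∑ i, φ i c • b i = c)
    (hX : let _ := dualComodule h; Function.Surjective (tensorCounit A C X (LeftDual A C))) :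
    Function.Surjective (moritaContext A C X).toS := by
  let _ := dualComodule h
  intro f
  obtain ⟨z, rfl⟩ := hX f
  induction z using BalTensor.induction with
  | zero => exact ⟨0, by rw [map_zero, map_zero]⟩
  | add z w hz hw =>
    obtain ⟨z', hz⟩ := hz
    obtain ⟨w', hw⟩ := hw
    exact ⟨z' + w', by rw [map_add, map_add, hz, hw]⟩
  | tmul q x =>
    exact ⟨tmul (comodEnd A C X)
      (⟨q.1, mem_moritaQ_of_mem_comoduleHom h q.1 q.2⟩ : moritaQ A C X) x, rfl⟩

end Dual

/-! ### Surjectivity of `X ⊗ Q → T`, finiteness of `X`, and the theorem. -/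

section Strict

variable {A C X : Type u} [Ring A] [AddCommGroup C] [Module A C] [Module Aᵐᵒᵖ C]
  [SMulCommClass A Aᵐᵒᵖ C] [Coring A C] [AddCommGroup X] [Module Aᵐᵒᵖ X] [RightComodule A C X]

variable (A C X) in
/-- The image of the connecting map `X ⊗ Q → T`, as a right ideal. -/
def rangeToT : Submodule (comodEnd A C X)ᵐᵒᵖ (comodEnd A C X) where
  __ := (moritaContext A C X).toT.range
  smul_mem' := by
    rintro t _ ⟨z, rfl⟩
    exact ⟨t • z, (moritaContext A C X).toT_op_smul t z⟩

/-- A tensor is rebuilt from its contractions, and contracting the class of `t` tensored with `x`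
gives the class of `t(xqᵢ)`, which lies in the image of `toT` by left `T`-linearity. -/
theorem tmul_quotient_rangeToT_eq_zero (hS : Function.Surjective (moritaContext A C X).toS)
    (z : BalTensor (comodEnd A C X) (comodEnd A C X ⧸ rangeToT A C X) X) : z = 0 := by
  obtain ⟨k, q, y, hqy⟩ := (moritaContext A C X).exists_sum_toS_eq_one hS
  rw [← (moritaContext A C X).sum_tmul_contract hqy z]
  refine Finset.sum_eq_zero fun i _ => ?_
  suffices h : (moritaContext A C X).contract _ (q i) z = 0 by rw [h, zero_tmul]
  induction z using BalTensor.induction with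
  | zero => exact map_zero _
  | add z w hz hw => rw [map_add, hz, hw, add_zero]
  | tmul n x =>
    obtain ⟨t, rfl⟩ := Submodule.Quotient.mk_surjective _ n
    refine (Submodule.Quotient.mk_eq_zero _).2 ⟨t • tmul _ x (q i), ?_⟩
    exact (moritaContext A C X).toT_smul t _

/-- The unit embeds `T/I` into comodule maps with values in `(T/I) ⊗_T X = 0`, so `T/I = 0`. -/
theorem toT_surjective (hS : Function.Surjective (moritaContext A C X).toS)
    (hU : Function.Injective (tensorUnit A C X (comodEnd A C X ⧸ rangeToT A C X))) :
    Function.Surjective (moritaContext A C X).toT := by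
  intro t
  refine (Submodule.Quotient.mk_eq_zero (rangeToT A C X)).1 (hU ?_)
  exact Subtype.ext (LinearMap.ext fun x =>
    (tmul_quotient_rangeToT_eq_zero hS _).trans (tmul_quotient_rangeToT_eq_zero hS _).symm)

theorem finite_and_projective [Module.Finite A C] [Module.Projective A C]
    (hT : Function.Surjective (moritaContext A C X).toT) :
    Module.Finite Aᵐᵒᵖ X ∧ Module.Projective Aᵐᵒᵖ X := by
  obtain ⟨n, b, φ, h⟩ := exists_dual_basis A C
  obtain ⟨k, x, q, hxq⟩ := (moritaContext A C X).exists_sum_toT_eq_one hT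
  -- Dual basis of `X`: elements `xᵢ · φⱼ` with functionals `y ↦ qᵢ(y)(bⱼ)`, from `y = ∑ xᵢ · qᵢ(y)`
  -- and the expansion of `qᵢ(y)` in the `φⱼ`.
  let f : X →ₗ[Aᵐᵒᵖ] (Fin k × Fin n → Aᵐᵒᵖ) :=
    { toFun := fun y p => op ((q p.1).1 y (b p.2))
      map_add' := fun y y' => funext fun p => by
        rw [_root_.map_add, LeftDual.add_apply, op_add]; rfl
      map_smul' := fun a y => funext fun p => by
        rw [_root_.map_smul, LeftDual.op_smul_apply, op_mul, op_unop]; rfl }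
  let g : (Fin k × Fin n → Aᵐᵒᵖ) →ₗ[Aᵐᵒᵖ] X :=
    Fintype.linearCombination Aᵐᵒᵖ fun p : Fin k × Fin n => comoduleAct X (φ p.2) (x p.1)
  have hgf : g ∘ₗ f = LinearMap.id := LinearMap.ext fun y => by
    rw [LinearMap.comp_apply, Fintype.linearCombination_apply, Fintype.sum_prod_type,
      LinearMap.id_apply]
    conv_rhs => rw [← sum_comoduleAct hxq y]
    refine Finset.sum_congr rfl fun i _ => ?_
    conv_rhs => rw [← sum_op_smul_dual h ((q i).1 y), comoduleAct_sum]
    exact Finset.sum_congr rfl fun j _ => (comoduleAct_op_smul X _ _ _).symm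
  exact ⟨Module.Finite.of_surjective g fun y => ⟨f y, LinearMap.congr_fun hgf y⟩,
    Module.Projective.of_split f g hgf⟩

end Strict

end CoringMorita

theorem mainTheorem8 {A : Type u} [Ring A] {C : Type u} [AddCommGroup C] [Module A C]
    [Module Aᵐᵒᵖ C] [SMulCommClass A Aᵐᵒᵖ C] [Coring A C]
    [Module.Finite A C] [Module.Projective A C]
    {X : Type u} [AddCommGroup X] [Module Aᵐᵒᵖ X] [RightComodule A C X] :
    List.TFAE
      [(moritaContext A C X).IsStrict,
        IsGaloisComodule A C X ∧ Module.Finite Aᵐᵒᵖ X ∧ Module.Projective Aᵐᵒᵖ X ∧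
          IsFaithfullyFlat (comodEnd A C X) X,
        ∃ e : CategoryTheory.Equivalence (ModuleCat.{u} (comodEnd A C X)ᵐᵒᵖ) (ComodCat A C),
          e.functor = tensorFunctor A C X ∧ e.inverse = homFunctor A C X] := by
  rw [exists_equivalence_iff]
  tfae_have 1 → 2 := fun h =>
    have hfp := finite_and_projective h.2.2
    ⟨fun N _ _ => can_bijective (tensorCounit_bijective h _), hfp.1, hfp.2, h.isFaithfullyFlat⟩
  tfae_have 2 → 3 := fun ⟨hG, _, _, hF⟩ =>
    have hM := hG.tensorCounit_bijective hF
    ⟨fun N _ _ => hF.tensorUnit_bijective N (hM _).1, hM⟩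
  tfae_have 3 → 1 := by
    rintro ⟨hN, hM⟩
    obtain ⟨n, b, φ, h⟩ := exists_dual_basis A C
    let _ := dualComodule h
    have hS := toS_surjective h (hM (LeftDual A C)).2
    exact (moritaContext A C X).isStrict_of_surjective hS (toT_surjective hS (hN _).1)
  tfae_finish
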